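/- **Circuits.** A set is constructible if it is a Boolean combination of zero sets of complex polynomials; a map between constructible subsets of affine spaces is *geometrically robust* if its graph is constructible and it is continuous for the Euclidean topologies. Let $\mathcal M\subseteq\mathbb A^r=\mathbb C^r$ be constructible and non-empty. A *circuit* $\beta$ with parameter domain $\mathcal M$ and inputs $X=(X_1,\dots,X_n)$ is a finite labelled directed acyclic graph. Its nodes of indegree zero are labelled by complex scalars, by the coordinate functions of $\mathcal M$ (basic parameters) or by inputs. Its other nodes have indegree two and are labelled by $+,-,\cdot$ or $/$. Some nodes are listed as outputs. It is *consistent* if no divisor vanishes identically on an irreducible component of $\mathcal M\times\mathbb A^n$, i.e. if the evaluation succeeds on a Zariski dense subset. It is *robust* if the rational map formed by the values of all nodes extends to a geometrically robust map on $\mathcal M\times\mathbb A^n$. The components of this map are the *intermediate results*, those at the outputs are the *final results*. All circuits below are consistent and robust unless otherwise said. A *parameter node* is one that does not depend on any input. **Generic computations.** A *shape* consists of finitely many families, indexed by tuples of natural numbers, of *generic computations*, i.e. ordinary arithmetic circuits over $\mathbb C$ whose variables are divided into parameter variables $W$, argument variables and standard variables. There are seven types: $R_{X}(W;X')$ for input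 nodes; $R_+(W;U,Y;X')$ and $R_{\cdot/}(W;U,Y;X')$ ($U$ a single variable) for addition of, and multiplication or division by, a parameter; $R_{add},R_{mult},R_{div}(W;Y,Z;X')$ for essential additions, multiplications and divisions (subtractions count as additions; a multiplication or addition is essential if both arguments depend on inputs, a division if its divisor does); and $R(W;Y;X')$. **Elementary routines.** A *routine* is a partial map $\mathcal A$ which sends circuits $\beta$ (the admissible inputs) to circuits $\mathcal A(\beta)$ with the same parameter domain. For a fixed shape, the *elementary* routines are those obtained by finitely many applications of the following constructions. * *Identity*: $\beta\mapsto\beta$. * *Isoparametric recursion*: for each node $\rho$ of $\beta$ that depends on an input choose a generic computation $R_\rho$ of the shape, of the type given by the label of $\rho$, and a vector $w_\rho$ of geometrically robust functions on $\mathcal M$ computed by a circuit without inputs (constants, if $\rho$ is an input node). The parameter nodes of $\beta$ are kept; at every other node $\rho$ the variables $W$ of $R_\rho$ are replaced by $w_\rho$ and its argument variables by the results $F_{\rho_1},F_{\rho_2}$ already obtained for the two predecessors (a parameter node contributes its own value), and the outputs of $R_\rho$ then give the vector $F_\rho$. The resulting circuit $\mathcal A(\beta)$ has as outputs the entries of $F_\rho$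 for the outputs $\rho$ of $\beta$. It is required that the vector lengths fit; that $\mathcal A(\beta)$ is consistent; that (A) $R_\rho$, restricted to the parameter domain given by the image of $w_\rho$ (and of the value of the first argument, if this is a parameter), is consistent and robust; and that (B) at each such $\rho$ the coefficient vector of $F_\rho$ with respect to the standard variables is $\sigma_\rho\circ\theta_\rho$, where $\theta_\rho$ is the coefficient vector of the intermediate result of $\beta$ at $\rho$ and $\sigma_\rho$ is geometrically robust on the image of $\theta_\rho$. * *Composition* of elementary routines, $\beta\mapsto\mathcal B(\mathcal A(\beta))$; *join*: the inputs of $\mathcal B(\beta)$ are replaced by output nodes of $\mathcal A(\beta)$, the result being required to be consistent; *union*: juxtaposition of $\mathcal A(\beta)$ and $\mathcal B(\beta)$. * *Application of a generic computation*: take $R(W;Y;X')$ in the shape and a vector $w_\beta$, empty if $W$ is empty and otherwise formed by the final results of $\mathcal W(\beta)$, where $\mathcal W$ is an elementary routine such that these final results do not depend on inputs. Replace $W$ by $w_\beta$ and $Y$ by the final results of $\beta$ (of the right number). It is required that (C) $R$, restricted to the parameter domain given by the image of $w_\beta$, is consistent and robust, and that the resulting circuit is consistent. * *Reduction and broadcasting*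 of the circuit $\mathcal A(\beta)$: finitely many steps, each of which either erases a node in favour of another one which has the same intermediate result and does not depend on it (the indexing of the outputs may change), or adjoins a circuit whose inputs are replaced by nodes of the given circuit, keeping the outputs and consistency. **Proposition.** Every elementary routine $\mathcal A$ of every shape is output isoparametric. Explicitly, let $\beta$ be a robust circuit with parameter domain $\mathcal M$ and inputs $X_1,\dots,X_n$ which is an admissible input for $\mathcal A$. Then the final results of $\beta$ are polynomials in $X_1,\dots,X_n$ whose coefficients (with respect to a suitable finite set of monomials) form a geometrically robust map on $\mathcal M$. Let $\theta$ be any geometrically robust map on $\mathcal M$ which represents the coefficient vector of the final results of $\beta$ with respect to some finite set of monomials, and let $\mathcal T:=\theta(\mathcal M)$. Then $\mathcal T$ is constructible, and there is a geometrically robust map $\sigma$ defined on $\mathcal T$ such that $\sigma\circ\theta$ is the coefficient vector (with respect to a suitable finite set of monomials in its inputs) of the final results of $\mathcal A(\beta)$; in particular, these final results are polynomials in the inputs of $\mathcal A(\beta)$. -/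

import Mathlib

namespace RobustModel

/-! ### Constructible sets and geometrically robust maps -/

/-- Boolean combinations of polynomial equations in the affine space with coordinates `ι`. -/
def Constructible {ι : Type} (S : Set (ι → ℂ)) : Prop :=
  S ∈ BooleanSubalgebra.closure
    (Set.range fun p : MvPolynomial ι ℂ => {z : ι → ℂ | MvPolynomial.eval z p = 0})

/-- The graph of the restriction of `φ` to `S`. -/
def graphOn {ι κ : Type} (S : Set (ι → ℂ)) (φ : (ι → ℂ) → κ → ℂ) : Set (ι ⊕ κ → ℂ) :=
  {z | (fun i => z (Sum.inl i)) ∈ S ∧ φ (fun i => z (Sum.inl i)) = fun k => z (Sum.inr k)}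

/-- The map `S → ℂ^κ` given by `φ` is constructible and continuous for the Euclidean topologies.
Only the values of `φ` on `S` matter. -/
def GeomRobustOn {ι κ : Type} (S : Set (ι → ℂ)) (φ : (ι → ℂ) → κ → ℂ) : Prop :=
  Constructible (graphOn S φ) ∧ ContinuousOn φ S

/-- A non-empty constructible subset of an affine space. -/
structure ParamDomain where
  r : ℕ
  carrier : Set (Fin r → ℂ)
  constructible : Constructible carrier
  nonempty : carrier.Nonempty

/-! ### Labelled directed acyclic graphs -/

inductive Op
  | add | sub | mul | div

/-- The label of a node together with its two ingoing edges, if it is internal. -/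
inductive Gate (P X N : Type)
  | scalar (c : ℂ)
  | param (i : P)
  | input (j : X)
  | op (o : Op) (a b : N)

/-- `g.IsArg a`: there is an edge from `a` into the node with gate `g`. -/
def Gate.IsArg {P X N : Type} (g : Gate P X N) (a : N) : Prop :=
  match g with
  | .op _ b c => a = b ∨ a = c
  | _ => False

def Gate.map {P P' X X' N N' : Type} (p : P → P') (x : X → X') (f : N → N') :
    Gate P X N → Gate P' X' N'
  | .scalar c => .scalar c
  | .param i => .param (p i)
  | .input j => .input (x j)
  | .op o a b => .op o (f a) (f b)

/-- A labelled DAG with basic parameters labelled by `P` and inputs labelled by `X`. -/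
structure Circuit (P X : Type) where
  Node : Type
  finite : Finite Node
  gate : Node → Gate P X Node
  acyclic : WellFounded fun a b => (gate b).IsArg a

namespace Circuit

variable {P X : Type} (C : Circuit P X)

/-- `C.DependsOn ν μ`: there is a path from `μ` to `ν`. -/
def DependsOn (ν μ : C.Node) : Prop :=
  Relation.ReflTransGen (fun a b => (C.gate b).IsArg a) μ ν

/-- The node depends on an input; the other nodes are the parameter nodes. -/
def Dep (ν : C.Node) : Prop := ∃ μ j, C.gate μ = .input j ∧ C.DependsOn ν μ

/-- The nodes that depend on at least one input. -/
abbrev DepNode : Type := {ν : C.Node // C.Dep ν}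

/-- `v` is the vector of the values of all nodes at the point `z`; the division nodes have
non-zero divisors. As `C` is acyclic, there is at most one `v` for each `z`. -/
def IsEvaluation (z : P ⊕ X → ℂ) (v : C.Node → ℂ) : Prop :=
  ∀ ν, match C.gate ν with
    | .scalar c => v ν = c
    | .param i => v ν = z (Sum.inl i)
    | .input j => v ν = z (Sum.inr j)
    | .op .add a b => v ν = v a + v b
    | .op .sub a b => v ν = v a - v b
    | .op .mul a b => v ν = v a * v b
    | .op .div a b => v b ≠ 0 ∧ v ν = v a / v b

/-- The circuit can be evaluated on a Zariski dense subset of `S`, i.e. no divisor vanishes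
identically on an irreducible component of `S`. -/
def ConsistentOn (S : Set (P ⊕ X → ℂ)) : Prop :=
  ∀ p : MvPolynomial (P ⊕ X) ℂ,
    (∀ z ∈ S, (∃ v, C.IsEvaluation z v) → MvPolynomial.eval z p = 0) →
      ∀ z ∈ S, MvPolynomial.eval z p = 0

/-- `Ω` is geometrically robust on `S` and extends the rational map on `S` given by the
intermediate results of `C`. -/
def IsRobustExtension (S : Set (P ⊕ X → ℂ)) (Ω : (P ⊕ X → ℂ) → C.Node → ℂ) : Prop :=
  GeomRobustOn S Ω ∧ ∀ z ∈ S, ∀ v, C.IsEvaluation z v → Ω z = v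

def RobustOn (S : Set (P ⊕ X → ℂ)) : Prop := ∃ Ω, C.IsRobustExtension S Ω

theorem Dep.of_isArg {C : Circuit P X} {a ν : C.Node} (h : (C.gate ν).IsArg a)
    (ha : C.Dep a) : C.Dep ν := by
  obtain ⟨μ, j, hj, hp⟩ := ha
  exact ⟨μ, j, hj, hp.tail h⟩

theorem Dep.of_input {C : Circuit P X} {ν : C.Node} {j : X} (h : C.gate ν = .input j) :
    C.Dep ν := ⟨ν, j, h, Relation.ReflTransGen.refl⟩

/-- The gates of the subgraph formed by the parameter nodes. -/
def parameterGate (ν : {ν : C.Node // ¬ C.Dep ν}) :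
    Gate P Empty {ν : C.Node // ¬ C.Dep ν} :=
  match h : C.gate ν.1 with
  | .scalar c => .scalar c
  | .param i => .param i
  | .input _ => (ν.2 (Dep.of_input h)).elim
  | .op o a b =>
    .op o ⟨a, fun ha => ν.2 (Dep.of_isArg (by rw [h]; exact Or.inl rfl) ha)⟩
      ⟨b, fun hb => ν.2 (Dep.of_isArg (by rw [h]; exact Or.inr rfl) hb)⟩

theorem isArg_of_parameterGate {ν a : {ν : C.Node // ¬ C.Dep ν}}
    (h : (C.parameterGate ν).IsArg a) : (C.gate ν.1).IsArg a.1 := by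
  unfold parameterGate at h
  split at h
  · exact h.elim
  · exact h.elim
  · rename_i h'
    exact (ν.2 (Dep.of_input h')).elim
  · rename_i h'
    rw [h']
    rcases h with h | h
    · exact Or.inl (congrArg Subtype.val h)
    · exact Or.inr (congrArg Subtype.val h)

/-- The part of a circuit which consists of its parameter nodes. -/
def parameterPart : Circuit P Empty where
  Node := {ν : C.Node // ¬ C.Dep ν}
  finite := by
    have := C.finite
    infer_instance
  gate := C.parameterGate
  acyclic := Subrelation.wf (fun h => C.isArg_of_parameterGate h)
    (InvImage.wf Subtype.val C.acyclic)

end Circuit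

/-! ### Assembling circuits from pieces -/

structure Piece where
  P : Type
  X : Type
  circ : Circuit P X

/-- Nodes of a piece whose label has to be replaced by a node of another piece. -/
def Gate.IsWired {P' X' N P X T : Type} (pw : P' → P ⊕ T) (xw : X' → X ⊕ T)
    (g : Gate P' X' N) : Prop :=
  match g with
  | .param i => (pw i).isRight = true
  | .input j => (xw j).isRight = true
  | _ => False

/-- `γ` is the labelled DAG obtained from the disjoint union of the pieces `C i` as follows. A
parameter or input label of a piece is either renamed to a label of `γ`, or the nodes carrying it
are replaced by (identified with) a given node of another piece; this is prescribed by `pw` and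
`xw`. The map `e` sends the nodes of the pieces to nodes of `γ`; it is a bijection from the nodes
that are not replaced to the nodes of `γ`. -/
structure IsAssembly {P X I : Type} (C : I → Piece)
    (pw : ∀ i, (C i).P → P ⊕ (Σ j, (C j).circ.Node))
    (xw : ∀ i, (C i).X → X ⊕ (Σ j, (C j).circ.Node))
    (γ : Circuit P X) (e : (Σ i, (C i).circ.Node) → γ.Node) : Prop where
  gate : ∀ i ν, match (C i).circ.gate ν with
    | .scalar c => γ.gate (e ⟨i, ν⟩) = .scalar c
    | .param k =>
      (∀ q, pw i k = Sum.inl q → γ.gate (e ⟨i, ν⟩) = .param q) ∧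
        ∀ t, pw i k = Sum.inr t → e ⟨i, ν⟩ = e t
    | .input k =>
      (∀ q, xw i k = Sum.inl q → γ.gate (e ⟨i, ν⟩) = .input q) ∧
        ∀ t, xw i k = Sum.inr t → e ⟨i, ν⟩ = e t
    | .op o a b => γ.gate (e ⟨i, ν⟩) = .op o (e ⟨i, a⟩) (e ⟨i, b⟩)
  bijective : Function.Bijective
    fun ν : {ν : Σ i, (C i).circ.Node // ¬ ((C ν.1).circ.gate ν.2).IsWired (pw ν.1) (xw ν.1)} =>
      e ν.1

/-- The entries of a list of length `n`, as a vector. -/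
def entry {α : Type} {n : ℕ} (l : List α) (h : l.length = n) (i : Fin n) : α :=
  l.get (i.cast h.symm)

/-! ### Robust parameterized arithmetic circuits -/

/-- The set `M × 𝔸^X`. -/
def ParamDomain.times (M : ParamDomain) (X : Type) : Set (Fin M.r ⊕ X → ℂ) :=
  {z | (fun i => z (Sum.inl i)) ∈ M.carrier}

/-- A consistent, robust circuit with parameter domain `M`, inputs `X` and listed output nodes. -/
structure RobustCircuit (M : ParamDomain) where
  X : Type
  finite : Finite X
  circ : Circuit (Fin M.r) X
  out : List circ.Node
  consistent : circ.ConsistentOn (M.times X)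
  robust : circ.RobustOn (M.times X)

namespace RobustCircuit

variable {M : ParamDomain}

/-- The intermediate result at the node `ν`, as a function of parameters and inputs, i.e. the
component at `ν` of the (on `M × 𝔸^X` unique) robust extension. -/
noncomputable def result (β : RobustCircuit M) (ν : β.circ.Node) (u : Fin M.r → ℂ)
    (x : β.X → ℂ) : ℂ :=
  Classical.choose β.robust (Sum.elim u x) ν

/-- For `u ∈ M`, the results at the nodes of the list `L` are polynomials in the inputs with
exponents in `D`, and `θ u` is the vector of their coefficients. -/
def IsCoeffMap (β : RobustCircuit M) (L : List β.circ.Node) (D : Finset (β.X →₀ ℕ))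
    (θ : (Fin M.r → ℂ) → (Fin L.length × D) → ℂ) : Prop :=
  ∀ u ∈ M.carrier, ∀ (x : β.X → ℂ) (k : Fin L.length),
    β.result (L.get k) u x = ∑ d : D, θ u (k, d) * d.1.prod fun i m => x i ^ m

/-- The coefficients of the results of `γ` at `L'` depend on the coefficients of the results of
`β` at `L` through a geometrically robust map. -/
def Isoparametric (β γ : RobustCircuit M) (L : List β.circ.Node) (L' : List γ.circ.Node) :
    Prop :=
  ∀ (D : Finset (β.X →₀ ℕ)) (θ : (Fin M.r → ℂ) → (Fin L.length × D) → ℂ),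
    GeomRobustOn M.carrier θ → β.IsCoeffMap L D θ →
      ∃ (D' : Finset (γ.X →₀ ℕ))
        (σ : ((Fin L.length × D) → ℂ) → (Fin L'.length × D') → ℂ),
        GeomRobustOn (θ '' M.carrier) σ ∧ γ.IsCoeffMap L' D' (fun u => σ (θ u))

def piece (β : RobustCircuit M) : Piece := ⟨Fin M.r, β.X, β.circ⟩

/-- All final results are parameters, i.e. they do not depend on the inputs. -/
def ComputesParameters (β : RobustCircuit M) : Prop :=
  ∀ ν ∈ β.out, ∀ u ∈ M.carrier, ∀ x x' : β.X → ℂ, β.result ν u x = β.result ν u x'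

end RobustCircuit

/-! ### Generic computations and shapes -/

/-- An ordinary arithmetic circuit over `ℂ` whose variables are subdivided into parameter
variables, two blocks of argument variables, and standard variables. -/
structure GenericComputation where
  W : ℕ
  Y : ℕ
  Z : ℕ
  X : ℕ
  circ : Circuit (Fin W) (Fin Y ⊕ Fin Z ⊕ Fin X)
  out : List circ.Node

def GenericComputation.piece (R : GenericComputation) : Piece :=
  ⟨Fin R.W, Fin R.Y ⊕ Fin R.Z ⊕ Fin R.X, R.circ⟩

/-- The types of generic computations: for input nodes; for addition of, and multiplication or
division by, a parameter; for essential additions, multiplications and divisions; and those which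
are not applied at nodes but to the final results of a circuit. Subtractions count as additions. -/
inductive GenSort
  | var | plus | scale | add | mult | div | general

/-- The argument blocks: none for input nodes, a single variable and a vector for operations with
a parameter, one vector for the last type. -/
def GenericComputation.HasSort (R : GenericComputation) : GenSort → Prop
  | .var => R.Y = 0 ∧ R.Z = 0
  | .plus => R.Y = 1
  | .scale => R.Y = 1
  | .general => R.Z = 0
  | _ => True

/-- Finitely many families of generic computations, indexed by tuples of natural numbers. -/
structure Shape where
  num : GenSort → ℕ
  arity : ∀ s, Fin (num s) → ℕ
  comp : ∀ s (k : Fin (num s)), (Fin (arity s k) → ℕ) → GenericComputation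
  hasSort : ∀ s k t, (comp s k t).HasSort s
  var_pos : 0 < num .var

def Shape.Mem (S : Shape) (s : GenSort) (R : GenericComputation) : Prop :=
  ∃ k t, S.comp s k t = R

/-! ### Recursive routines -/

open Classical in
/-- The type of generic computation used at a node that depends on an input. -/
noncomputable def Circuit.sortOf {P X : Type} (C : Circuit P X) (ν : C.Node) : GenSort :=
  match C.gate ν with
  | .op .add a b | .op .sub a b => if C.Dep a ∧ C.Dep b then .add else .plus
  | .op .mul a b => if C.Dep a ∧ C.Dep b then .mult else .scale
  | .op .div _ b => if C.Dep b then .div else .scale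
  | _ => .var

open Classical in
/-- The node (none for input nodes) whose results replace the first argument block: the left
predecessor, except that a predecessor which is a parameter node always comes first. -/
noncomputable def Circuit.fstArg {P X : Type} (C : Circuit P X) (ν : C.Node) : List C.Node :=
  match C.gate ν with
  | .op _ a b => if C.Dep a ∧ ¬ C.Dep b then [b] else [a]
  | _ => []

open Classical in
/-- The node (none for input nodes) whose results replace the second argument block. -/
noncomputable def Circuit.sndArg {P X : Type} (C : Circuit P X) (ν : C.Node) : List C.Node :=
  match C.gate ν with
  | .op _ a b => if C.Dep a ∧ ¬ C.Dep b then [a] else [b]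
  | _ => []

/-- The pieces of the output of a recursive routine: the parameter nodes of the input circuit and,
for each other node, a precomputation of parameters and a generic computation. -/
inductive RecPiece (N : Type)
  | base
  | par (ρ : N)
  | gen (ρ : N)

/-- The choices of a recursive routine on the input `β`: for each node which depends on an input,
a generic computation of the shape and a circuit without inputs over `M` which computes the
parameters at the node (complex numbers, if the node is an input node). -/
structure RecChoice (S : Shape) {M : ParamDomain} (β : RobustCircuit M) where
  gen : β.circ.DepNode → GenericComputation
  gen_mem : ∀ ρ, S.Mem (β.circ.sortOf ρ.1) (gen ρ)
  par : β.circ.DepNode → RobustCircuit M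
  par_isEmpty : ∀ ρ, IsEmpty (par ρ).X
  par_length : ∀ ρ, (par ρ).out.length = (gen ρ).W
  par_const : ∀ ρ : β.circ.DepNode, (∃ j, β.circ.gate ρ.1 = .input j) →
    ∀ ν ∈ (par ρ).out, ∃ c, ∀ u ∈ M.carrier, ∀ x, (par ρ).result ν u x = c

namespace RecChoice

variable {S : Shape} {M : ParamDomain} {β : RobustCircuit M} (d : RecChoice S β)

def pieces : RecPiece β.circ.DepNode → Piece
  | .base => ⟨Fin M.r, Empty, β.circ.parameterPart⟩
  | .par ρ => (d.par ρ).piece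
  | .gen ρ => (d.gen ρ).piece

open Classical in
/-- The nodes of the pieces which carry the results `F_ρ` corresponding to the node `ρ`: the
outputs of its generic computation, or the node itself if it is a parameter node. -/
noncomputable def refs (ρ : β.circ.Node) : List (Σ i, (d.pieces i).circ.Node) :=
  if h : β.circ.Dep ρ then (d.gen ⟨ρ, h⟩).out.map fun ν => ⟨.gen ⟨ρ, h⟩, ν⟩
  else [⟨.base, ⟨ρ, h⟩⟩]

/-- The values of the parameters at `ρ` and, if the first argument of `ρ` is a parameter, of this
parameter; all the remaining variables of the generic computation at `ρ` are free. -/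
def specialization (ρ : β.circ.DepNode) :
    Set (Fin (d.gen ρ).W ⊕ (Fin (d.gen ρ).Y ⊕ Fin (d.gen ρ).Z ⊕ Fin (d.gen ρ).X) → ℂ) :=
  {z | ∃ u ∈ M.carrier,
    (∀ i x, z (Sum.inl i) = (d.par ρ).result (entry (d.par ρ).out (d.par_length ρ) i) u x) ∧
    ∀ a ∈ β.circ.fstArg ρ.1, ¬ β.circ.Dep a → ∀ i x,
      z (Sum.inr (Sum.inl i)) = β.result a u x}

def paramWire : ∀ i, (d.pieces i).P → Fin M.r ⊕ (Σ j, (d.pieces j).circ.Node)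
  | .base => Sum.inl
  | .par _ => Sum.inl
  | .gen ρ => fun k => Sum.inr ⟨.par ρ, entry (d.par ρ).out (d.par_length ρ) k⟩

/-- The argument variables are replaced by the results at the predecessors, the standard variables
are renamed by `v`. -/
noncomputable def inputWire {X : Type}
    (hY : ∀ ρ : β.circ.DepNode, ((β.circ.fstArg ρ.1).flatMap d.refs).length = (d.gen ρ).Y)
    (hZ : ∀ ρ : β.circ.DepNode, ((β.circ.sndArg ρ.1).flatMap d.refs).length = (d.gen ρ).Z)
    (v : ∀ ρ, Fin (d.gen ρ).X → X) :
    ∀ i, (d.pieces i).X → X ⊕ (Σ j, (d.pieces j).circ.Node)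
  | .base => fun x => nomatch x
  | .par ρ => fun x => ((d.par_isEmpty ρ).false x).elim
  | .gen ρ => Sum.elim (fun k => Sum.inr (entry _ (hY ρ) k))
      (Sum.elim (fun k => Sum.inr (entry _ (hZ ρ) k)) (fun k => Sum.inl (v ρ k)))

end RecChoice

/-- `γ` is the result of an isoparametric recursive routine applied to `β`. The conditions are:
the lengths of the argument vectors fit; the specialized generic computations are consistent and
robust; `γ` is obtained by joining the pieces; and at each node the coefficients of the results
depend on those of the intermediate result of `β` by a geometrically robust map. -/
def IsRecursionResult (S : Shape) {M : ParamDomain} (β γ : RobustCircuit M) : Prop :=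
  ∃ (d : RecChoice S β)
    (hY : ∀ ρ : β.circ.DepNode, ((β.circ.fstArg ρ.1).flatMap d.refs).length = (d.gen ρ).Y)
    (hZ : ∀ ρ : β.circ.DepNode, ((β.circ.sndArg ρ.1).flatMap d.refs).length = (d.gen ρ).Z)
    (v : ∀ ρ, Fin (d.gen ρ).X → γ.X)
    (e : (Σ i, (d.pieces i).circ.Node) → γ.circ.Node),
    (∀ ρ, Function.Injective (v ρ)) ∧
    (∀ ρ, (d.gen ρ).circ.ConsistentOn (d.specialization ρ) ∧
      (d.gen ρ).circ.RobustOn (d.specialization ρ)) ∧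
    IsAssembly d.pieces d.paramWire (d.inputWire hY hZ v) γ.circ e ∧
    γ.out = (β.out.flatMap d.refs).map e ∧
    ∀ ρ : β.circ.DepNode, β.Isoparametric γ [ρ.1] ((d.refs ρ.1).map e)

/-! ### Further operations with circuits -/

/-- The pieces of an assembly of two circuits. -/
def twoPieces {M : ParamDomain} (α δ : RobustCircuit M) : Bool → Piece
  | false => α.piece
  | true => δ.piece

def twoParamWire {M : ParamDomain} (α δ : RobustCircuit M) :
    ∀ i, (twoPieces α δ i).P → Fin M.r ⊕ (Σ j, (twoPieces α δ j).circ.Node)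
  | false => Sum.inl
  | true => Sum.inl

/-- The inputs of `α` are renamed by `v`, those of `δ` are treated according to `w`. -/
def twoInputWire {M : ParamDomain} (α δ : RobustCircuit M) {X : Type} (v : α.X → X)
    (w : δ.X → X ⊕ (Σ j, (twoPieces α δ j).circ.Node)) :
    ∀ i, (twoPieces α δ i).X → X ⊕ (Σ j, (twoPieces α δ j).circ.Node)
  | false => fun k => Sum.inl (v k)
  | true => w

/-- `γ` is the join of `α` with `δ`: the inputs of `δ` are replaced by output nodes of `α`
according to `l`. -/
def IsJoin {M : ParamDomain} (α δ γ : RobustCircuit M) : Prop :=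
  ∃ (v : α.X → γ.X) (l : δ.X → Fin α.out.length)
    (e : (Σ i, (twoPieces α δ i).circ.Node) → γ.circ.Node),
    Function.Injective v ∧
    IsAssembly (twoPieces α δ) (twoParamWire α δ)
      (twoInputWire α δ v fun k => Sum.inr ⟨false, α.out.get (l k)⟩) γ.circ e ∧
    γ.out = δ.out.map fun ν => e ⟨true, ν⟩

/-- `γ` is the juxtaposition of `α` and `δ`; the circuits may have inputs in common. -/
def IsUnion {M : ParamDomain} (α δ γ : RobustCircuit M) : Prop :=
  ∃ (v : α.X → γ.X) (w : δ.X → γ.X)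
    (e : (Σ i, (twoPieces α δ i).circ.Node) → γ.circ.Node),
    Function.Injective v ∧ Function.Injective w ∧
    IsAssembly (twoPieces α δ) (twoParamWire α δ)
      (twoInputWire α δ v fun k => Sum.inl (w k)) γ.circ e ∧
    γ.out = (α.out.map fun ν => e ⟨false, ν⟩) ++ δ.out.map fun ν => e ⟨true, ν⟩

/-- `γ` is obtained from `β` by adjoining a circuit `δ` whose inputs are replaced by pairwise
distinct nodes of `β`; the outputs remain those of `β`. -/
def IsBroadcastStep {M : ParamDomain} (β γ : RobustCircuit M) : Prop :=
  ∃ (δ : RobustCircuit M) (v : β.X → γ.X) (y : δ.X → β.circ.Node)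
    (e : (Σ i, (twoPieces β δ i).circ.Node) → γ.circ.Node),
    Function.Bijective v ∧ Function.Injective y ∧
    IsAssembly (twoPieces β δ) (twoParamWire β δ)
      (twoInputWire β δ v fun k => Sum.inr ⟨false, y k⟩) γ.circ e ∧
    γ.out = β.out.map fun ν => e ⟨false, ν⟩

/-- `γ` is obtained from `β` by erasing a node `ρ'` in favour of a node `ρ` which has the same
intermediate result and does not depend on `ρ'`. The indexing of the outputs may change. -/
def IsReductionStep {M : ParamDomain} (β γ : RobustCircuit M) : Prop :=
  ∃ (ρ ρ' : β.circ.Node) (v : β.X → γ.X) (f : β.circ.Node → γ.circ.Node),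
    ¬ β.circ.DependsOn ρ ρ' ∧
    (∀ u ∈ M.carrier, ∀ x, β.result ρ u x = β.result ρ' u x) ∧
    Function.Bijective v ∧
    f ρ' = f ρ ∧
    Function.Bijective (fun ν : {ν : β.circ.Node // ν ≠ ρ'} => f ν.1) ∧
    (∀ ν, ν ≠ ρ' → γ.circ.gate (f ν) = (β.circ.gate ν).map id v f) ∧
    ∀ τ, τ ∈ γ.out ↔ ∃ ν ∈ β.out, f ν = τ

/-- Finitely many reduction and broadcasting steps. -/
def IsRewriting {M : ParamDomain} : RobustCircuit M → RobustCircuit M → Prop :=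
  Relation.ReflTransGen fun β γ => IsReductionStep β γ ∨ IsBroadcastStep β γ

inductive AppPiece
  | arg | par | gen

/-- The circuit `β`, a circuit `ω` which computes parameters, and a generic computation. -/
def appPieces {M : ParamDomain} (R : GenericComputation) (ω β : RobustCircuit M) :
    AppPiece → Piece
  | .arg => β.piece
  | .par => ω.piece
  | .gen => R.piece

def appParamWire {M : ParamDomain} (R : GenericComputation) (ω β : RobustCircuit M)
    (hW : ω.out.length = R.W) :
    ∀ i, (appPieces R ω β i).P → Fin M.r ⊕ (Σ j, (appPieces R ω β j).circ.Node)
  | .arg => Sum.inl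
  | .par => Sum.inl
  | .gen => fun k => Sum.inr ⟨.par, entry ω.out hW k⟩

def appInputWire {M : ParamDomain} (R : GenericComputation) (ω β : RobustCircuit M)
    (hY : β.out.length = R.Y) (hZ : R.Z = 0) {X : Type} (v : β.X → X) (w : ω.X → X)
    (t : Fin R.X → X) :
    ∀ i, (appPieces R ω β i).X → X ⊕ (Σ j, (appPieces R ω β j).circ.Node)
  | .arg => fun k => Sum.inl (v k)
  | .par => fun k => Sum.inl (w k)
  | .gen => Sum.elim (fun k => Sum.inr ⟨.arg, entry β.out hY k⟩)
      (Sum.elim (fun k => (Fin.cast hZ k).elim0) (fun k => Sum.inl (t k)))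

/-- The image of the final results of `ω` times the space of the other variables of `R`. -/
def appSpecialization {M : ParamDomain} (R : GenericComputation) (ω : RobustCircuit M)
    (hW : ω.out.length = R.W) :
    Set (Fin R.W ⊕ (Fin R.Y ⊕ Fin R.Z ⊕ Fin R.X) → ℂ) :=
  {z | ∃ u ∈ M.carrier, ∀ i x, z (Sum.inl i) = ω.result (entry ω.out hW i) u x}

/-- `γ` is obtained from the generic computation `R` by replacing its parameter variables by the
final results of `ω`, which are parameters, and its argument variables by the final results of
`β`; the specialized generic computation has to be consistent and robust. -/
def IsApplication {M : ParamDomain} (R : GenericComputation) (ω β γ : RobustCircuit M) : Prop :=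
  ω.ComputesParameters ∧
  ∃ (hW : ω.out.length = R.W) (hY : β.out.length = R.Y) (hZ : R.Z = 0)
    (v : β.X → γ.X) (w : ω.X → γ.X) (t : Fin R.X → γ.X)
    (e : (Σ i, (appPieces R ω β i).circ.Node) → γ.circ.Node),
    Function.Injective v ∧ Function.Injective w ∧ Function.Injective t ∧
    R.circ.ConsistentOn (appSpecialization R ω hW) ∧
    R.circ.RobustOn (appSpecialization R ω hW) ∧
    IsAssembly (appPieces R ω β) (appParamWire R ω β hW) (appInputWire R ω β hY hZ v w t)
      γ.circ e ∧
    γ.out = R.out.map fun ν => e ⟨.gen, ν⟩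

/-! ### Elementary routines -/

/-- Partial maps between robust circuits which preserve the parameter domain; the circuits in the
domain of a routine are its admissible inputs. -/
abbrev Routine : Type 1 := ∀ M : ParamDomain, RobustCircuit M →. RobustCircuit M

/-- The elementary routines of the computation model of shape `S`. -/
inductive IsElementary (S : Shape) : Routine → Prop
  | identity : IsElementary S fun M => PFun.id (RobustCircuit M)
  | recursion (A : Routine)
      (h : ∀ M β γ, γ ∈ A M β → IsRecursionResult S β γ) : IsElementary S A
  | composition (A B : Routine) (hA : IsElementary S A) (hB : IsElementary S B) :
      IsElementary S fun M => (B M).comp (A M)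
  | join (A B C : Routine) (hA : IsElementary S A) (hB : IsElementary S B)
      (h : ∀ M β γ, γ ∈ C M β → ∃ α ∈ A M β, ∃ δ ∈ B M β, IsJoin α δ γ) : IsElementary S C
  | union (A B C : Routine) (hA : IsElementary S A) (hB : IsElementary S B)
      (h : ∀ M β γ, γ ∈ C M β → ∃ α ∈ A M β, ∃ δ ∈ B M β, IsUnion α δ γ) : IsElementary S C
  /-- If the generic computation has parameter variables, these are replaced by the final results
  of an elementary routine; otherwise nothing is precomputed. -/
  | application (A C : Routine) (hA : IsElementary S A)
      (h : ∀ M β γ, γ ∈ C M β → ∃ R, S.Mem .general R ∧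
        ∃ ω, (if R.W = 0 then IsEmpty ω.circ.Node else ω ∈ A M β) ∧ IsApplication R ω β γ) :
      IsElementary S C
  | rewriting (A C : Routine) (hA : IsElementary S A)
      (h : ∀ M β γ, γ ∈ C M β → ∃ α ∈ A M β, IsRewriting α γ) : IsElementary S C

end RobustModel

namespace RobustModel

section

open MvPolynomial PrimeSpectrum

/-! ### Constructible sets and robust maps -/

/-! Fix `θ` on the parameter domain. The functions `σ ∘ θ`, with `σ` geometrically robust on the
image of `θ`, form a ℂ-algebra (`factorSubalgebra`). Call a function of parameters and inputs
admissible if it is a polynomial in the inputs over this algebra (`IsPol`). Admissible functions are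
closed under substitution, and the theorem says that admissible final results of `β` give admissible
final results of `A(β)`. This is proved by induction on the construction of the routine
(`IsElementary.isPol`), with `θ` fixed throughout.

Three facts carry the induction. Chevalley's theorem (`Constructible.image_comp`) makes images and
compositions of robust maps constructible. Next, a constructible set is Euclidean dense in its
Zariski closure (`mem_closure_of_eval_eq_zero`). Continuous functions which agree wherever a
consistent circuit can be evaluated are therefore equal, so a result of a composite circuit may be
computed at such points, where an evaluation restricts to the pieces (`IsAssembly.isEvaluation`).
Finally, the results of a consistent robust circuit are polynomials in the inputs with robust
coefficients (`Circuit.exists_robust_coefficients`): over a good parameter point they are continuous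
quotients of polynomials, hence polynomials of bounded degree. Interpolation makes their
coefficients robust, and density covers the other points.

For unions, joins and applications, admissibility then follows by substitution. In a recursion it is
the isoparametricity condition at a node that composes with the factorization through `θ`, while
parameter nodes keep their values. Rewriting does not change the results at the outputs. -/

theorem mem_pointToPoint_asIdeal {ι : Type} {z : ι → ℂ} {p : MvPolynomial ι ℂ} :
    p ∈ (pointToPoint (k := ℂ) z).asIdeal ↔ eval z p = 0 := by
  rw [pointToPoint, mem_vanishingIdeal_singleton_iff, aeval_eq_eval]

/-- The points of a union of basic locally closed sets. -/
def dataPoints {ι : Type} (T : ConstructibleSetData (MvPolynomial ι ℂ)) : Set (ι → ℂ) :=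
  {z | ∃ C ∈ T, (∀ i, eval z (C.g i) = 0) ∧ eval z C.f ≠ 0}

theorem mem_basicToSet {ι : Type} {C : BasicConstructibleSetData (MvPolynomial ι ℂ)}
    {q : PrimeSpectrum (MvPolynomial ι ℂ)} :
    q ∈ C.toSet ↔ (∀ i, C.g i ∈ q.asIdeal) ∧ C.f ∉ q.asIdeal := by
  simp [BasicConstructibleSetData.toSet, PrimeSpectrum.mem_zeroLocus, Set.range_subset_iff]

theorem preimage_pointToPoint_toSet {ι : Type} (T : ConstructibleSetData (MvPolynomial ι ℂ)) :
    pointToPoint (k := ℂ) (K := ℂ) ⁻¹' T.toSet = dataPoints T := by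
  ext z
  simp only [ConstructibleSetData.toSet, Set.mem_preimage, Set.mem_iUnion, mem_basicToSet,
    mem_pointToPoint_asIdeal, dataPoints, Set.mem_ofPred_eq, exists_prop]

namespace Constructible

variable {ι κ : Type}

theorem zeros (p : MvPolynomial ι ℂ) : Constructible {z : ι → ℂ | eval z p = 0} :=
  BooleanSubalgebra.subset_closure ⟨p, rfl⟩

theorem compl {S : Set (ι → ℂ)} (h : Constructible S) : Constructible Sᶜ :=
  BooleanSubalgebra.compl_mem h

theorem inter {S T : Set (ι → ℂ)} (h : Constructible S) (h' : Constructible T) :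
    Constructible (S ∩ T) := BooleanSubalgebra.inf_mem h h'

theorem union {S T : Set (ι → ℂ)} (h : Constructible S) (h' : Constructible T) :
    Constructible (S ∪ T) := BooleanSubalgebra.sup_mem h h'

theorem univ : Constructible (Set.univ : Set (ι → ℂ)) := BooleanSubalgebra.top_mem

theorem iInter {α : Type} [Finite α] {S : α → Set (ι → ℂ)} (h : ∀ a, Constructible (S a)) :
    Constructible (⋂ a, S a) := BooleanSubalgebra.iInf_mem h

theorem preimage {S : Set (κ → ℂ)} (h : Constructible S) (g : κ → MvPolynomial ι ℂ) :
    Constructible {z : ι → ℂ | (fun k => eval z (g k)) ∈ S} := by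
  induction h using BooleanSubalgebra.closure_bot_sup_induction with
  | mem x hx =>
    obtain ⟨p, rfl⟩ := hx
    convert! zeros (bind₁ g p) using 2
    ext z
    exact (congrArg (· = 0) (by rw [← aeval_eq_eval, ← aeval_eq_eval, aeval_bind₁])).to_iff
  | bot => exact BooleanSubalgebra.bot_mem
  | sup x hx y hy h1 h2 => exact h1.union h2
  | compl x hx h => exact h.compl

theorem preimage_comp {S : Set (κ → ℂ)} (h : Constructible S) (f : κ → ι) :
    Constructible {z : ι → ℂ | (fun k => z (f k)) ∈ S} := by
  simpa using h.preimage fun k => X (f k)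

theorem exists_isConstructible {S : Set (ι → ℂ)} (h : Constructible S) :
    ∃ T : Set (PrimeSpectrum (MvPolynomial ι ℂ)), Topology.IsConstructible T ∧
      pointToPoint (k := ℂ) ⁻¹' T = S := by
  induction h using BooleanSubalgebra.closure_bot_sup_induction with
  | mem x hx =>
    obtain ⟨p, rfl⟩ := hx
    refine ⟨(basicOpen p : Set _)ᶜ, isConstructible_basicOpen.compl, ?_⟩
    ext z
    simp [mem_pointToPoint_asIdeal]
  | bot => exact ⟨∅, .empty, rfl⟩
  | sup x hx y hy h1 h2 =>
    obtain ⟨T, hT, rfl⟩ := h1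
    obtain ⟨T', hT', rfl⟩ := h2
    exact ⟨T ∪ T', hT.union hT', rfl⟩
  | compl x hx h =>
    obtain ⟨T, hT, rfl⟩ := h
    exact ⟨Tᶜ, hT.compl, rfl⟩

theorem exists_data {S : Set (ι → ℂ)} (h : Constructible S) :
    ∃ T : ConstructibleSetData (MvPolynomial ι ℂ), dataPoints T = S := by
  obtain ⟨T, hT, rfl⟩ := h.exists_isConstructible
  obtain ⟨T, rfl⟩ := exists_constructibleSetData_iff.2 hT
  exact ⟨T, (preimage_pointToPoint_toSet T).symm⟩

theorem dataPoints (T : ConstructibleSetData (MvPolynomial ι ℂ)) :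
    Constructible (dataPoints T) := by
  have : RobustModel.dataPoints T =
      ⋃ C : T, ((⋂ i, {z | eval z (C.1.g i) = 0}) ∩ {z | eval z C.1.f = 0}ᶜ) := by
    ext z
    simp only [RobustModel.dataPoints, Set.mem_ofPred_eq, Set.mem_iUnion, Set.mem_inter_iff,
      Set.mem_iInter, Set.mem_compl_iff, Subtype.exists, exists_prop]
  rw [this]
  exact BooleanSubalgebra.iSup_mem fun C => (iInter fun i => zeros _).inter (zeros _).compl

/-- The finiteness condition under which Chevalley's theorem applies to the map of spectra. Both
rings are finitely presented over ℂ. -/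
theorem finitePresentation_rename [Finite ι] [Finite κ] (f : ι → κ) :
    (rename f : MvPolynomial ι ℂ →ₐ[ℂ] MvPolynomial κ ℂ).toRingHom.FinitePresentation := by
  refine RingHom.FinitePresentation.of_comp_finiteType
    (algebraMap ℂ (MvPolynomial ι ℂ)) ?_ ?_
  · have : (rename f : MvPolynomial ι ℂ →ₐ[ℂ] MvPolynomial κ ℂ).toRingHom.comp
        (algebraMap ℂ (MvPolynomial ι ℂ)) = algebraMap ℂ (MvPolynomial κ ℂ) := by
      ext; simp
    rw [this]
    exact RingHom.finitePresentation_algebraMap.2 inferInstance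
  · exact RingHom.finiteType_algebraMap.2 inferInstance

/-- Chevalley's theorem describes the image in the prime spectrum. A point of the spectrum over `x`
need not be closed, but the Nullstellensatz replaces it by a complex point of the fibre in the same
basic piece. -/
theorem image_comp [Finite ι] [Finite κ] {S : Set (κ → ℂ)} (h : Constructible S) (f : ι → κ) :
    Constructible ((fun z i => z (f i)) '' S) := by
  obtain ⟨T, rfl⟩ := h.exists_data
  have hT := isConstructible_comap_image (finitePresentation_rename f) T.isConstructible_toSet
  obtain ⟨T', hT'⟩ := exists_constructibleSetData_iff.2 hT
  convert! dataPoints T' using 1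
  rw [← preimage_pointToPoint_toSet T', hT', ← preimage_pointToPoint_toSet]
  ext x
  constructor
  · rintro ⟨z, hz, rfl⟩
    refine ⟨_, hz, PrimeSpectrum.ext (Ideal.ext fun p => ?_)⟩
    simp [mem_pointToPoint_asIdeal, eval_rename, Function.comp_def]
  · rintro ⟨q, hq, hqx⟩
    simp only [ConstructibleSetData.toSet, Set.mem_iUnion, mem_basicToSet] at hq
    obtain ⟨C, hC, hg, hf⟩ := hq
    -- The ideal of the closed conditions of the piece together with those of the fibre over `x`.
    -- Since `q` contains `J` but not `C.f`, no power of `C.f` lies in `J`.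
    set J : Ideal (MvPolynomial κ ℂ) := Ideal.span (Set.range C.g) ⊔
      (pointToPoint (k := ℂ) x).asIdeal.map (rename f).toRingHom
    have hJ : J ≤ q.asIdeal := by
      refine sup_le ?_ ?_
      · rw [Ideal.span_le]
        rintro _ ⟨i, rfl⟩
        exact hg i
      · rw [Ideal.map_le_iff_le_comap, ← hqx]
        exact le_rfl
    have hfJ : C.f ∉ J.radical := fun h => hf ((q.2.radical_le_iff.2 hJ) h)
    rw [← vanishingIdeal_zeroLocus_eq_radical (K := ℂ), mem_vanishingIdeal_iff] at hfJ
    push Not at hfJ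
    obtain ⟨z, hz, hzf⟩ := hfJ
    rw [mem_zeroLocus_iff] at hz
    refine ⟨z, ?_, ?_⟩
    · simp only [ConstructibleSetData.toSet, Set.mem_preimage, Set.mem_iUnion, mem_basicToSet,
        mem_pointToPoint_asIdeal]
      refine ⟨C, hC, fun i => ?_, hzf⟩
      exact hz _ (Ideal.mem_sup_left (Ideal.subset_span ⟨i, rfl⟩))
    · funext i
      have : rename f (X i - MvPolynomial.C (x i)) ∈ J :=
        Ideal.mem_sup_right (Ideal.mem_map_of_mem _ (mem_pointToPoint_asIdeal.2 (by simp)))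
      have := hz _ this
      simpa [sub_eq_zero] using this

end Constructible

theorem mem_graphOn {ι κ : Type} {S : Set (ι → ℂ)} {φ : (ι → ℂ) → κ → ℂ} {z : ι ⊕ κ → ℂ} :
    z ∈ graphOn S φ ↔ (fun i => z (.inl i)) ∈ S ∧
      φ (fun i => z (.inl i)) = fun k => z (.inr k) := Iff.rfl

/-! ### Calculus of geometrically robust maps -/

namespace GeomRobustOn

variable {ι κ μ : Type} {S : Set (ι → ℂ)} {φ : (ι → ℂ) → κ → ℂ}

theorem congr {ψ : (ι → ℂ) → κ → ℂ} (h : GeomRobustOn S φ) (hφ : ∀ z ∈ S, ψ z = φ z) :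
    GeomRobustOn S ψ := by
  refine ⟨?_, h.2.congr hφ⟩
  convert! h.1 using 1
  ext z
  simp only [mem_graphOn]
  exact and_congr_right fun hz => by rw [hφ _ hz]

/-- The graph is the intersection of the pulled-back graphs of the components. Constructibility of
`S` has to be given, because for empty `κ` there are no components to yield it. -/
theorem pi [Finite κ] (hS : Constructible S)
    (h : ∀ k, GeomRobustOn S fun z (_ : Unit) => φ z k) : GeomRobustOn S φ := by
  refine ⟨?_, continuousOn_pi.2 fun k => continuousOn_pi.1 (h k).2 ()⟩
  convert! (hS.preimage_comp (Sum.inl : ι → ι ⊕ κ)).inter (Constructible.iInter fun k =>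
    (h k).1.preimage_comp (Sum.map id fun _ => k : ι ⊕ Unit → ι ⊕ κ)) using 1
  ext z
  simp only [mem_graphOn, Set.mem_inter_iff, Set.mem_iInter, Set.mem_ofPred_eq]
  constructor
  · rintro ⟨h1, h2⟩
    exact ⟨h1, fun k => ⟨h1, funext fun _ => congrFun h2 k⟩⟩
  · rintro ⟨h1, h2⟩
    exact ⟨h1, funext fun k => congrFun (h2 k).2 ()⟩

theorem polynomial [Finite κ] (hS : Constructible S) (p : κ → MvPolynomial ι ℂ) :
    GeomRobustOn S fun z k => eval z (p k) := by
  refine pi hS fun k => ⟨?_, ?_⟩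
  · convert! (hS.preimage_comp (Sum.inl : ι → ι ⊕ Unit)).inter
      (Constructible.zeros (rename Sum.inl (p k) - X (Sum.inr ()))) using 1
    ext z
    simp only [mem_graphOn, Set.mem_inter_iff, Set.mem_ofPred_eq, map_sub, eval_rename, eval_X,
      sub_eq_zero]
    exact and_congr_right fun _ => ⟨fun h => congrFun h (), fun h => funext fun _ => h⟩
  · exact continuousOn_pi.2 fun _ => (MvPolynomial.continuous_eval _).continuousOn

variable [Finite ι] [Finite κ]

theorem constructible (h : GeomRobustOn S φ) : Constructible S := by
  convert! h.1.image_comp (Sum.inl : ι → ι ⊕ κ) using 1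
  ext x
  constructor
  · exact fun hx => ⟨Sum.elim x (φ x), ⟨hx, rfl⟩, rfl⟩
  · rintro ⟨z, hz, rfl⟩
    exact hz.1

theorem image (h : GeomRobustOn S φ) : Constructible (φ '' S) := by
  convert! h.1.image_comp (Sum.inr : κ → ι ⊕ κ) using 1
  ext y
  constructor
  · rintro ⟨x, hx, rfl⟩
    exact ⟨Sum.elim x (φ x), ⟨hx, rfl⟩, rfl⟩
  · rintro ⟨z, hz, rfl⟩
    exact ⟨_, hz.1, hz.2⟩

/-- The graph of the composition is the projection of the fibre product of the two graphs, which
forgets the middle coordinates. -/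
theorem comp [Finite μ] {S' : Set (κ → ℂ)} {ψ : (κ → ℂ) → μ → ℂ} (hψ : GeomRobustOn S' ψ)
    (h : GeomRobustOn S φ) (hm : ∀ z ∈ S, φ z ∈ S') : GeomRobustOn S fun z => ψ (φ z) := by
  refine ⟨?_, hψ.2.comp h.2 hm⟩
  convert! ((h.1.preimage_comp (Sum.map id Sum.inl : ι ⊕ κ → ι ⊕ κ ⊕ μ)).inter
    (hψ.1.preimage_comp (Sum.inr : κ ⊕ μ → ι ⊕ κ ⊕ μ))).image_comp
    (Sum.map id Sum.inr : ι ⊕ μ → ι ⊕ κ ⊕ μ) using 1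
  ext z
  constructor
  · rintro ⟨h1, h2⟩
    refine ⟨Sum.elim (z ∘ Sum.inl) (Sum.elim (φ (z ∘ Sum.inl)) (z ∘ Sum.inr)),
      ⟨⟨h1, rfl⟩, ⟨hm _ h1, h2⟩⟩, ?_⟩
    funext i
    rcases i with i | i <;> rfl
  · rintro ⟨z, ⟨⟨h1, h2⟩, ⟨h3, h4⟩⟩, rfl⟩
    refine ⟨h1, ?_⟩
    change ψ (φ _) = _
    exact (congrArg ψ h2).trans h4

theorem component [Finite μ] (h : GeomRobustOn S φ) (f : μ → κ) :
    GeomRobustOn S fun z m => φ z (f m) := by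
  refine ⟨?_, ?_⟩
  · convert! h.1.image_comp (Sum.map id f : ι ⊕ μ → ι ⊕ κ) using 1
    ext z
    constructor
    · rintro ⟨h1, h2⟩
      refine ⟨Sum.elim (z ∘ Sum.inl) (φ (z ∘ Sum.inl)), ⟨h1, rfl⟩, ?_⟩
      funext i
      rcases i with i | i
      · rfl
      · exact congrFun h2 i
    · rintro ⟨z, ⟨h1, h2⟩, rfl⟩
      exact ⟨h1, funext fun m => congrFun h2 (f m)⟩
  · exact continuousOn_pi.2 fun m => (continuousOn_pi.1 h.2) (f m)

end GeomRobustOn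

end

open MvPolynomial

/-! ### Density of Zariski open sets -/

theorem mem_closure_eval_ne_zero {σ : Type} [Finite σ] {g : MvPolynomial σ ℂ} (hg : g ≠ 0)
    (t : σ → ℂ) : t ∈ closure {a : σ → ℂ | eval a g ≠ 0} := by
  have := Fintype.ofFinite σ
  rw [Metric.mem_closure_iff]
  intro ε hε
  by_contra! h
  refine hg (funext_set (fun i => Metric.ball (t i) ε) (fun i => ?_) fun a ha => ?_)
  · exact infinite_of_mem_nhds (t i) (Metric.ball_mem_nhds _ hε)
  · by_contra hne
    refine absurd (h a (by simpa using hne)) (not_le.2 ?_)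
    rw [dist_comm]
    exact (dist_pi_lt_iff hε).2 fun i => ha i trivial

/-- The value at `s` is the product of the distances to the roots, up to a phase; if all distances
were at least `ε`, it could not be this small. -/
theorem exists_root_dist_lt {F : Polynomial ℂ} (hF : F.Monic) {s : ℂ}
    {ε : ℝ} (hε : 0 < ε) (h : ‖F.eval s‖ < ε ^ F.natDegree) :
    ∃ x, F.IsRoot x ∧ ‖s - x‖ < ε := by
  by_contra! hx
  refine absurd h (not_lt.2 ?_)
  have hs := IsAlgClosed.splits F
  rw [hs.eval_eq_prod_roots_of_monic hF, hs.natDegree_eq_card_roots]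
  have : ∀ m : Multiset ℂ, (∀ x ∈ m, ε ≤ ‖s - x‖) →
      ε ^ m.card ≤ ‖(m.map fun x => s - x).prod‖ := by
    intro m
    induction m using Multiset.induction with
    | empty => simp
    | cons a m ih =>
      intro hm
      simp only [Multiset.card_cons, Multiset.map_cons, Multiset.prod_cons, norm_mul, pow_succ']
      exact mul_le_mul (hm a (by simp)) (ih fun x hx => hm x (by simp [hx])) (by positivity)
        (by positivity)
  exact this _ fun x hx' => hx x (Polynomial.isRoot_of_mem_roots hx')

theorem exists_bound_roots {σ : Type} [Finite σ] {F : Polynomial (MvPolynomial σ ℂ)}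
    (hF : F.Monic) {K : Set (σ → ℂ)} (hK : IsCompact K) :
    ∃ R : ℝ, ∀ t ∈ K, ∀ x, (F.map (eval t)).IsRoot x → ‖x‖ ≤ R := by
  have hb : ∀ i, ∃ C : NNReal, ∀ t ∈ K, ‖(F.map (eval t)).coeff i‖₊ ≤ C := fun i => by
    obtain ⟨C, hC⟩ := hK.exists_bound_of_continuousOn
      (f := fun t => (F.map (eval t)).coeff i)
      (by simpa only [Polynomial.coeff_map] using (MvPolynomial.continuous_eval _).continuousOn)
    exact ⟨C.toNNReal, fun t ht => NNReal.coe_le_coe.1 ((hC t ht).trans (Real.le_coe_toNNReal C))⟩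
  choose C hC using hb
  refine ⟨((Finset.range F.natDegree).sup C + 1 : NNReal), fun t ht x hx => ?_⟩
  have hm := hF.map (eval t)
  refine (hx.norm_lt_cauchyBound hm.ne_zero).le.trans ?_
  norm_cast
  rw [Polynomial.cauchyBound, hm.leadingCoeff, hF.natDegree_map]
  simp only [nnnorm_one, div_one]
  exact add_le_add_left (Finset.sup_mono_fun fun i _ => hC i t ht) 1

/-- A root of the specialized minimal polynomial of an integral element over a normal domain is
the value of this element at a point over the given one. -/
theorem exists_algHom_of_isRoot_minpoly {A B : Type} [CommRing A] [IsDomain A]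
    [IsIntegrallyClosed A] [CommRing B] [IsDomain B] [Algebra ℂ A] [Algebra ℂ B] [Algebra A B]
    [IsScalarTower ℂ A B] [Algebra.FiniteType ℂ B] [Algebra.IsIntegral A B]
    [Module.IsTorsionFree A B] (h : B) (φ : A →ₐ[ℂ] ℂ) {s : ℂ}
    (hs : ((minpoly A h).map (φ : A →+* ℂ)).IsRoot s) :
    ∃ ψ : B →ₐ[ℂ] ℂ, (∀ a, ψ (algebraMap A B a) = φ a) ∧ ψ h = s := by
  let χ : Polynomial A →+* ℂ := Polynomial.eval₂RingHom (φ : A →+* ℂ) s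
  let j : Polynomial A →+* B := (Polynomial.aeval h).toRingHom
  algebraize [j]
  have hint : Algebra.IsIntegral (Polynomial A) B := by
    refine ⟨fun b => ?_⟩
    obtain ⟨p, hp, hpb⟩ := Algebra.IsIntegral.isIntegral (R := A) b
    refine ⟨p.map Polynomial.C, hp.map _, ?_⟩
    rw [Polynomial.eval₂_map]
    convert! hpb using 2
    ext a
    exact Polynomial.aeval_C h a
  have hχ : Function.Surjective χ := fun c => ⟨Polynomial.C (algebraMap ℂ A c), by simp [χ]⟩
  have := RingHom.ker_isMaximal_of_surjective χ hχ
  -- Normality of `A` enters here: every polynomial over `A` which kills `h` is a multiple of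
  -- `minpoly A h`. So the kernel of `j` lies in that of `χ`, and lying over applies.
  obtain ⟨Q, hQ, hQχ⟩ := Ideal.exists_ideal_over_maximal_of_isIntegral (S := B) (RingHom.ker χ)
    (by
      intro p hp
      obtain ⟨q, rfl⟩ := minpoly.isIntegrallyClosed_dvd (Algebra.IsIntegral.isIntegral h) hp
      have : χ (minpoly A h) = 0 := by
        rwa [Polynomial.IsRoot, Polynomial.eval_map] at hs
      simp [RingHom.mem_ker, this])
  -- The residue field is of finite type over ℂ, hence equal to ℂ, and `ψ` is the reduction modulo
  -- `Q`.
  let _ : Field (B ⧸ Q) := Ideal.Quotient.field Q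
  have := finite_of_finite_type_of_isJacobsonRing ℂ (B ⧸ Q)
  have hbij := IsAlgClosed.algebraMap_bijective_of_isIntegral (k := ℂ) (K := B ⧸ Q)
  let E : ℂ ≃ₐ[ℂ] B ⧸ Q := AlgEquiv.ofBijective (Algebra.ofId ℂ (B ⧸ Q)) hbij
  let ψ : B →ₐ[ℂ] ℂ := E.symm.toAlgHom.comp (Ideal.Quotient.mkₐ ℂ Q)
  have hψ : ∀ p : Polynomial A, ψ (j p) = χ p := by
    intro p
    have h1 : p - Polynomial.C (algebraMap ℂ A (χ p)) ∈ RingHom.ker χ := by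
      simp [RingHom.mem_ker, χ]
    rw [← hQχ, Ideal.mem_comap] at h1
    have h2 : ψ (j (p - Polynomial.C (algebraMap ℂ A (χ p)))) = 0 := by
      change E.symm (Ideal.Quotient.mk Q _) = 0
      exact (congrArg E.symm (Ideal.Quotient.eq_zero_iff_mem.2 h1)).trans (map_zero _)
    have h3 : j (Polynomial.C (algebraMap ℂ A (χ p))) = algebraMap ℂ B (χ p) := by
      change Polynomial.aeval h (Polynomial.C (algebraMap ℂ A (χ p))) = _
      rw [Polynomial.aeval_C, ← IsScalarTower.algebraMap_apply]
    rw [map_sub, map_sub, h3, AlgHom.commutes, sub_eq_zero] at h2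
    exact h2
  refine ⟨ψ, fun a => ?_, ?_⟩
  · have := hψ (Polynomial.C a)
    simpa [j, χ] using this
  · have := hψ Polynomial.X
    simpa [j, χ] using this

/-- By Noether normalization the variety is finite over an affine space. Move the image of `z`
slightly, off a hypersurface over whose complement `f` has no zero, and lift the new point so that a
function `L` separating `z` within its fibre changes little. Such lifts stay bounded, and a limit
point lies in the fibre of `z` with the same value of `L`, so it is `z`. -/
theorem mem_closure_of_isPrime {ι : Type} [Finite ι] (P : Ideal (MvPolynomial ι ℂ)) [P.IsPrime]
    {f : MvPolynomial ι ℂ} (hf : f ∉ P) {z : ι → ℂ} (hz : ∀ p ∈ P, eval z p = 0) :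
    z ∈ closure {w : ι → ℂ | (∀ p ∈ P, eval w p = 0) ∧ eval w f ≠ 0} := by
  classical
  have := Fintype.ofFinite ι
  let B := MvPolynomial ι ℂ ⧸ P
  let mk : MvPolynomial ι ℂ →ₐ[ℂ] B := Ideal.Quotient.mkₐ ℂ P
  have hmk : Function.Surjective mk := Ideal.Quotient.mk_surjective
  obtain ⟨s, g, ginj, gint⟩ := exists_integral_inj_algHom_of_fg ℂ B
  let A := MvPolynomial (Fin s) ℂ
  let _ : Algebra A B := g.toRingHom.toAlgebra
  have hAB : ∀ a, algebraMap A B a = g a := fun _ => rfl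
  have : IsScalarTower ℂ A B := IsScalarTower.of_algebraMap_eq fun c => (g.commutes c).symm
  have : Algebra.IsIntegral A B := ⟨gint⟩
  have : FaithfulSMul A B := (faithfulSMul_iff_algebraMap_injective A B).2 ginj
  -- points of the variety and algebra homomorphisms
  have hlift : ∀ w : ι → ℂ, (∀ p ∈ P, eval w p = 0) →
      ∃ ψ : B →ₐ[ℂ] ℂ, ∀ q, ψ (mk q) = eval w q := fun w hw =>
    ⟨Ideal.Quotient.liftₐ P (aeval w) fun p hp => by simpa [aeval_eq_eval] using hw p hp,
      fun q => by rw [← aeval_eq_eval]; rfl⟩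
  have hpt : ∀ ψ : B →ₐ[ℂ] ℂ, ∃ w : ι → ℂ, ∀ q, ψ (mk q) = eval w q := fun ψ => by
    refine ⟨fun i => ψ (mk (X i)), fun q => ?_⟩
    have : ψ.comp mk = aeval fun i => ψ (mk (X i)) := by ext; simp
    rw [← aeval_eq_eval, ← this]
    rfl
  have hP : ∀ (ψ : B →ₐ[ℂ] ℂ) (w : ι → ℂ), (∀ q, ψ (mk q) = eval w q) →
      ∀ p ∈ P, eval w p = 0 := fun ψ w h p hp => by
    rw [← h, show mk p = 0 from Ideal.Quotient.eq_zero_iff_mem.2 hp, map_zero]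
  choose q hq using fun j : Fin s => hmk (g (X j))
  let π : (ι → ℂ) → Fin s → ℂ := fun w j => eval w (q j)
  have hπc : Continuous π := continuous_pi fun j => MvPolynomial.continuous_eval _
  have hπ : ∀ (ψ : B →ₐ[ℂ] ℂ) (w : ι → ℂ), (∀ q, ψ (mk q) = eval w q) →
      ∀ a, ψ (g a) = eval (π w) a := fun ψ w h a => by
    have : ψ.comp g = aeval (π w) := by
      ext j
      simp [← hq, h, π]
    rw [← aeval_eq_eval, ← this]
    rfl
  have hroot : ∀ (ψ : B →ₐ[ℂ] ℂ) (w : ι → ℂ), (∀ q, ψ (mk q) = eval w q) →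
      ∀ b, ((minpoly A b).map (eval (π w))).IsRoot (ψ b) := fun ψ w h b => by
    have h0 : Polynomial.eval₂ (algebraMap A B) b (minpoly A b) = 0 := minpoly.aeval A b
    have := congrArg ψ h0
    rw [map_zero, ← AlgHom.coe_toRingHom, Polynomial.hom_eval₂] at this
    rw [Polynomial.IsRoot, Polynomial.eval_map]
    convert! this using 2
    ext a
    · simp [hAB]
    · simp [hAB, hπ ψ w h]
  have hmonic : ∀ b : B, (minpoly A b).Monic := fun b =>
    minpoly.monic (Algebra.IsIntegral.isIntegral b)
  -- the finite fibre, and a polynomial which separates `z` from its other points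
  let p0 := π z
  -- A finite box containing the fibre: each coordinate of a point over `p0` is a root of the
  -- specialized minimal polynomial of that coordinate function.
  let G : Finset (ι → ℂ) := Fintype.piFinset fun i =>
    ((minpoly A (mk (X i))).map (eval p0)).roots.toFinset
  have hG : ∀ w : ι → ℂ, (∀ p ∈ P, eval w p = 0) → π w = p0 → w ∈ G := fun w hw hw0 => by
    obtain ⟨ψ, hψ⟩ := hlift w hw
    refine Fintype.mem_piFinset.2 fun i => ?_
    rw [Multiset.mem_toFinset, Polynomial.mem_roots ((hmonic _).map _).ne_zero, ← hw0]
    simpa [hψ] using hroot ψ w hψ (mk (X i))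
  have hsep : ∃ L : MvPolynomial ι ℂ, eval z L ≠ 0 ∧ ∀ w ∈ G, w ≠ z → eval w L = 0 := by
    have h1 : ∀ w : ι → ℂ, ∃ l : MvPolynomial ι ℂ, eval w l = 0 ∧ (w ≠ z → eval z l ≠ 0) := by
      intro w
      by_cases hw : w = z
      · exact ⟨0, by simp, fun h => absurd hw h⟩
      · obtain ⟨i, hi⟩ := Function.ne_iff.1 hw
        exact ⟨X i - C (w i), by simp, fun _ => by simpa [sub_eq_zero] using hi.symm⟩
    choose l hl hl' using h1
    refine ⟨∏ w ∈ G.erase z, l w, ?_, fun w hw hwz => ?_⟩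
    · rw [map_prod]
      exact Finset.prod_ne_zero_iff.2 fun w hw => hl' w (Finset.ne_of_mem_erase hw)
    · rw [map_prod]
      exact Finset.prod_eq_zero (Finset.mem_erase.2 ⟨hwz, hw⟩) (hl w)
  obtain ⟨L, hLz, hL⟩ := hsep
  obtain ⟨ψz, hψz⟩ := hlift z hz
  -- Since `f` divides `d` in `B`, it is non-zero at every point whose image under `π` is not a zero
  -- of `d`.
  obtain ⟨d, hd0, e, hde⟩ : ∃ d : A, d ≠ 0 ∧ mk f ∣ algebraMap A B d :=
    IsAlgebraic.exists_nonzero_dvd (Algebra.IsIntegral.isIntegral (R := A) (mk f)).isAlgebraic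
      (mem_nonZeroDivisors_of_ne_zero fun h => hf (Ideal.Quotient.eq_zero_iff_mem.1 h))
  let F := minpoly A (mk L)
  have happrox : ∀ ε > 0, ∃ w : ι → ℂ, (∀ p ∈ P, eval w p = 0) ∧ eval w f ≠ 0 ∧
      dist (π w) p0 < ε ∧ ‖eval z L - eval w L‖ < ε := by
    intro ε hε
    -- The second condition produces a root of the specialized `F` within `ε` of `L(z)`. It holds at
    -- `p0`, where `L(z)` is itself a root.
    have hopen : IsOpen {t : Fin s → ℂ | dist t p0 < ε ∧
        ‖(F.map (eval t)).eval (eval z L)‖ < ε ^ F.natDegree} := by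
      refine (isOpen_lt (continuous_id.dist continuous_const) continuous_const).inter
        (isOpen_lt (Continuous.norm ?_) continuous_const)
      simp only [Polynomial.eval_map, Polynomial.eval₂_eq_sum_range]
      exact continuous_finsetSum _ fun i _ =>
        (MvPolynomial.continuous_eval _).mul continuous_const
    have hmem : dist p0 p0 < ε ∧ ‖(F.map (eval p0)).eval (eval z L)‖ < ε ^ F.natDegree := by
      refine ⟨by simpa using hε, ?_⟩
      have := hroot ψz z hψz (mk L)
      rw [hψz] at this
      rw [show (F.map (eval p0)).eval (eval z L) = 0 from this, norm_zero]
      positivity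
    obtain ⟨t, ⟨ht1, ht2⟩, htd⟩ := mem_closure_iff.1 (mem_closure_eval_ne_zero hd0 p0) _ hopen hmem
    have hFm : (F.map (eval t)).Monic := (hmonic _).map _
    obtain ⟨x, hx, hxε⟩ := exists_root_dist_lt hFm hε
      (by rwa [(hmonic _).natDegree_map])
    obtain ⟨ψ, hψ1, hψ2⟩ := exists_algHom_of_isRoot_minpoly (A := A) (mk L) (aeval t) (s := x) (by
      convert! hx using 2)
    obtain ⟨w, hw⟩ := hpt ψ
    have hwt : π w = t := funext fun j => by
      have := hψ1 (X j)
      rw [hAB, hπ ψ w hw, eval_X, aeval_X] at this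
      exact this
    refine ⟨w, hP ψ w hw, fun h0 => htd ?_, by rwa [hwt], ?_⟩
    · rw [← hwt, ← hπ ψ w hw, ← hAB, hde, map_mul, hw, h0, zero_mul]
    · rwa [← hw, hψ2]
  -- a sequence of approximations converges to `z`
  choose w hwP hwf hwπ hwL using fun n : ℕ => happrox (1 / (n + 1)) Nat.one_div_pos_of_nat
  have hK := isCompact_closedBall p0 1
  choose R hR using fun i => exists_bound_roots (hmonic (mk (X i))) hK
  have hbd : ∀ n, w n ∈ {w : ι → ℂ | ∀ i, ‖w i‖ ≤ R i} := fun n i => by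
    obtain ⟨ψ, hψ⟩ := hlift (w n) (hwP n)
    refine hR i (π (w n)) ?_ _ ?_
    · refine Metric.mem_closedBall.2 ((hwπ n).le.trans ?_)
      rw [div_le_one (by positivity)]
      linarith [Nat.cast_nonneg (α := ℝ) n]
    · simpa [hψ] using hroot ψ (w n) hψ (mk (X i))
  have hbd' : Bornology.IsBounded {w : ι → ℂ | ∀ i, ‖w i‖ ≤ R i} := by
    refine (Bornology.IsBounded.pi fun i => Metric.isBounded_closedBall (x := (0 : ℂ)) (r := R i)).subset ?_
    intro w hw i _
    simpa using hw i
  obtain ⟨a, -, φ, hφ, hlim⟩ := tendsto_subseq_of_bounded hbd' hbd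
  have h0 : Filter.Tendsto (fun n => (1 : ℝ) / ((φ n : ℕ) + 1)) Filter.atTop (nhds 0) :=
    tendsto_one_div_add_atTop_nhds_zero_nat.comp hφ.tendsto_atTop
  have haP : ∀ p ∈ P, eval a p = 0 := fun p hp =>
    tendsto_nhds_unique (((MvPolynomial.continuous_eval p).tendsto a).comp hlim)
      (tendsto_const_nhds.congr fun n => (hwP _ p hp).symm)
  have haπ : π a = p0 := tendsto_nhds_unique ((hπc.tendsto a).comp hlim)
    (tendsto_iff_dist_tendsto_zero.2 (squeeze_zero (fun _ => dist_nonneg)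
      (fun n => (hwπ (φ n)).le) h0))
  have haL : eval a L = eval z L := tendsto_nhds_unique
    (((MvPolynomial.continuous_eval L).tendsto a).comp hlim)
    (tendsto_iff_norm_sub_tendsto_zero.2 (squeeze_zero (fun _ => norm_nonneg _)
      (fun n => by rw [norm_sub_rev]; exact (hwL (φ n)).le) h0))
  have haz : a = z := by
    by_contra hne
    exact hLz (haL ▸ hL a (hG a haP haπ) hne)
  rw [← haz]
  exact mem_closure_of_tendsto hlim (Filter.Eventually.of_forall fun n => ⟨hwP _, hwf _⟩)

/-- Zariski closure and Euclidean closure of a constructible set coincide; the proof reduces to an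
irreducible component of the Zariski closure of one locally closed piece. -/
theorem mem_closure_of_eval_eq_zero {ι : Type} [Finite ι] {U : Set (ι → ℂ)} (hU : Constructible U)
    {z : ι → ℂ} (hz : ∀ p : MvPolynomial ι ℂ, (∀ w ∈ U, eval w p = 0) → eval z p = 0) :
    z ∈ closure U := by
  obtain ⟨T, rfl⟩ := hU.exists_data
  let piece (D : PrimeSpectrum.BasicConstructibleSetData (MvPolynomial ι ℂ)) : Set (ι → ℂ) :=
    {w | (∀ i, eval w (D.g i) = 0) ∧ eval w D.f ≠ 0}
  obtain ⟨D, hD, hzD⟩ : ∃ D ∈ T, ∀ p : MvPolynomial ι ℂ,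
      (∀ w ∈ piece D, eval w p = 0) → eval z p = 0 := by
    -- If `z` were outside the Zariski closure of every piece, the product of separating polynomials
    -- would vanish on the union but not at `z`.
    by_contra! h
    choose! p hp hpz using h
    refine absurd (hz (∏ D ∈ T, p D) fun w hw => ?_) ?_
    · obtain ⟨D, hD, hw⟩ := hw
      rw [map_prod]
      exact Finset.prod_eq_zero hD (hp D hD w hw)
    · rw [map_prod]
      exact Finset.prod_ne_zero_iff.2 hpz
  let J : Ideal (MvPolynomial ι ℂ) := vanishingIdeal ℂ (piece D)
  have hJ : ∀ p, p ∈ J ↔ ∀ w ∈ piece D, eval w p = 0 := fun p => by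
    simp only [J, mem_vanishingIdeal_iff, aeval_eq_eval]
  obtain ⟨P, hP, hPz⟩ := Ideal.exists_minimalPrimes_le (I := J)
    (J := (pointToPoint (k := ℂ) z).asIdeal)
    fun p hp => mem_pointToPoint_asIdeal.2 (hzD p ((hJ p).1 hp))
  have := hP.1.1
  -- An element of a minimal prime over `J` is a zero divisor modulo `J`, whereas `D.f` has no zero
  -- on the piece.
  have hf : D.f ∉ P := fun hf => by
    obtain ⟨y, hy, hfy⟩ := Ideal.exists_mul_mem_of_mem_minimalPrimes hP hf
    refine hy ((hJ y).2 fun w hw => ?_)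
    have := (hJ _).1 hfy w hw
    rw [map_mul] at this
    exact (mul_eq_zero.1 this).resolve_left hw.2
  refine closure_mono ?_ (mem_closure_of_isPrime P hf fun p hp =>
    mem_pointToPoint_asIdeal.1 (hPz hp))
  rintro w ⟨hw, hwf⟩
  exact ⟨D, hD, fun i => hw _ (hP.1.2 ((hJ _).2 fun w hw => hw.1 i)), hwf⟩

/-! ### Evaluation of circuits -/

/-- The numerator and denominator of the result of an operation; the denominator vanishes where the
operation cannot be performed. -/
noncomputable def Op.frac {R : Type} [CommRing R] (o : Op) (a b : R × R) : R × R :=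
  match o with
  | .add => (a.1 * b.2 + b.1 * a.2, a.2 * b.2)
  | .sub => (a.1 * b.2 - b.1 * a.2, a.2 * b.2)
  | .mul => (a.1 * b.1, a.2 * b.2)
  -- The factor `b.2` is kept in both entries so that the denominator also records that the divisor
  -- is defined.
  | .div => (a.1 * b.2 * b.2, a.2 * b.1 * b.2)

namespace Circuit

variable {P X : Type} (C : Circuit P X)

/-- Numerator and denominator of the rational function computed at a node. -/
noncomputable def frac : C.Node → MvPolynomial (P ⊕ X) ℂ × MvPolynomial (P ⊕ X) ℂ :=
  C.acyclic.fix fun ν rec =>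
    match h : C.gate ν with
    | .scalar c => (MvPolynomial.C c, 1)
    | .param i => (MvPolynomial.X (.inl i), 1)
    | .input j => (MvPolynomial.X (.inr j), 1)
    | .op o a b => o.frac (rec a (by rw [h]; exact Or.inl rfl)) (rec b (by rw [h]; exact Or.inr rfl))

theorem frac_eq (ν : C.Node) : C.frac ν =
    match C.gate ν with
    | .scalar c => (MvPolynomial.C c, 1)
    | .param i => (MvPolynomial.X (.inl i), 1)
    | .input j => (MvPolynomial.X (.inr j), 1)
    | .op o a b => o.frac (C.frac a) (C.frac b) := by
  rw [frac, WellFounded.fix_eq]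
  split <;> rename_i h <;> simp only [h]

variable {C}

theorem isEvaluation_iff {z : P ⊕ X → ℂ} {v : C.Node → ℂ} :
    C.IsEvaluation z v ↔
      ∀ ν, eval z (C.frac ν).2 ≠ 0 ∧ v ν = eval z (C.frac ν).1 / eval z (C.frac ν).2 := by
  constructor
  · intro hv ν
    induction ν using C.acyclic.induction with
    | h ν ih =>
    have hν := hv ν
    rw [frac_eq]
    cases hg : C.gate ν with
    | scalar c => simpa [hg] using hν
    | param i => simpa [hg] using hν
    | input j => simpa [hg] using hν
    | op o a b =>
      obtain ⟨ha, ha'⟩ := ih a (by rw [hg]; exact Or.inl rfl)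
      obtain ⟨hb, hb'⟩ := ih b (by rw [hg]; exact Or.inr rfl)
      cases o <;> simp only [hg] at hν <;> simp only [Op.frac, map_mul, map_add, map_sub]
      · rw [hν, ha', hb']
        exact ⟨mul_ne_zero ha hb, by field_simp⟩
      · rw [hν, ha', hb']
        exact ⟨mul_ne_zero ha hb, by field_simp⟩
      · rw [hν, ha', hb']
        exact ⟨mul_ne_zero ha hb, by field_simp⟩
      · obtain ⟨h0, hν⟩ := hν
        rw [hb'] at h0
        have h1 : eval z (C.frac b).1 ≠ 0 := fun h => h0 (by rw [h, zero_div])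
        rw [hν, ha', hb']
        exact ⟨mul_ne_zero (mul_ne_zero ha h1) hb, by field_simp⟩
  · intro h ν
    have hν := h ν
    rw [frac_eq] at hν
    cases hg : C.gate ν with
    | scalar c => simpa [hg] using hν
    | param i => simpa [hg] using hν
    | input j => simpa [hg] using hν
    | op o a b =>
      obtain ⟨ha, ha'⟩ := h a
      obtain ⟨hb, hb'⟩ := h b
      cases o <;> simp only [hg, Op.frac, map_mul, map_add, map_sub] at hν ⊢
      · rw [hν.2, ha', hb']
        field_simp
      · rw [hν.2, ha', hb']
        field_simp
      · rw [hν.2, ha', hb']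
        field_simp
      · have h1 : eval z (C.frac b).1 ≠ 0 := fun h => hν.1 (by simp [h])
        rw [hν.2, ha', hb']
        exact ⟨div_ne_zero h1 hb, by field_simp⟩

theorem exists_isEvaluation_iff {z : P ⊕ X → ℂ} :
    (∃ v, C.IsEvaluation z v) ↔ ∀ ν, eval z (C.frac ν).2 ≠ 0 :=
  ⟨fun ⟨_, hv⟩ ν => (isEvaluation_iff.1 hv ν).1,
    fun h => ⟨_, isEvaluation_iff.2 fun ν => ⟨h ν, rfl⟩⟩⟩

variable (C) in
theorem constructible_evaluable : Constructible {z | ∃ v, C.IsEvaluation z v} := by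
  have := C.finite
  convert! Constructible.iInter fun ν => (Constructible.zeros (C.frac ν).2).compl using 1
  ext z
  simp [exists_isEvaluation_iff]

/-- Consistency is Zariski density of the points of evaluation. These form a constructible set, so
they are also dense for the Euclidean topology. -/
theorem ConsistentOn.mem_closure [Finite P] [Finite X] {S : Set (P ⊕ X → ℂ)}
    (h : C.ConsistentOn S) (hS : Constructible S) {z : P ⊕ X → ℂ} (hz : z ∈ S) :
    z ∈ closure (S ∩ {z | ∃ v, C.IsEvaluation z v}) :=
  mem_closure_of_eval_eq_zero (hS.inter C.constructible_evaluable) fun p hp =>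
    h p (fun w hw hv => hp w ⟨hw, hv⟩) z hz

/-- Continuous functions which agree at the points where a consistent circuit can be evaluated
agree. -/
theorem ConsistentOn.eqOn [Finite P] [Finite X] {S : Set (P ⊕ X → ℂ)}
    (h : C.ConsistentOn S) (hS : Constructible S) {f g : (P ⊕ X → ℂ) → ℂ} (hf : ContinuousOn f S)
    (hg : ContinuousOn g S) (hfg : ∀ z ∈ S, ∀ v, C.IsEvaluation z v → f z = g z) :
    Set.EqOn f g S := by
  refine Set.EqOn.of_subset_closure (s := S ∩ {z | ∃ v, C.IsEvaluation z v}) ?_ hf hg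
    Set.inter_subset_left fun z hz => h.mem_closure hS hz
  rintro z ⟨hz, v, hv⟩
  exact hfg z hz v hv

end Circuit

/-! ### Continuous quotients of polynomials -/

theorem eq_of_mul_eval_eq {X : Type} [Finite X] {q : MvPolynomial X ℂ} (hq : q ≠ 0)
    {f g : (X → ℂ) → ℂ} (hf : Continuous f) (hg : Continuous g)
    (h : ∀ x, eval x q ≠ 0 → f x = g x) : f = g :=
  Continuous.ext_on (s := {x | eval x q ≠ 0}) (fun x => mem_closure_eval_ne_zero hq x) hf hg
    fun x hx => h x hx

/-- Remove the irreducible factors of `q` one at a time. On the zeros of such a factor `p` vanishes,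
so by the Nullstellensatz the factor divides `p`; after cancellation the identity holds off these
zeros, and everywhere by continuity. -/
theorem exists_eval_eq_of_continuous {X : Type} [Finite X] {q : MvPolynomial X ℂ} (hq : q ≠ 0)
    (p : MvPolynomial X ℂ) {f : (X → ℂ) → ℂ} (hf : Continuous f)
    (h : ∀ x, eval x q * f x = eval x p) :
    ∃ r, p = q * r ∧ ∀ x, f x = eval x r := by
  induction q using WfDvdMonoid.induction_on_irreducible generalizing p with
  | zero => exact absurd rfl hq
  | unit u hu =>
    obtain ⟨v, hv⟩ := hu.exists_right_inv
    refine ⟨v * p, by rw [← mul_assoc, hv, one_mul], fun x => ?_⟩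
    have := congrArg (eval x) hv
    rw [map_mul, map_one] at this
    rw [map_mul, ← h, ← mul_assoc, mul_comm (eval x v), this, one_mul]
  | mul a i ha hi ih =>
    have hip : i ∣ p := by
      have : (Ideal.span {i}).IsPrime := (Ideal.span_singleton_prime hi.ne_zero).2 hi.prime
      rw [← Ideal.mem_span_singleton, ← IsPrime.vanishingIdeal_zeroLocus (K := ℂ) (Ideal.span {i}),
        mem_vanishingIdeal_iff]
      intro x hx
      have h0 := hx i (Ideal.mem_span_singleton_self i)
      rw [aeval_eq_eval] at h0 ⊢
      rw [← h, map_mul, h0, zero_mul, zero_mul]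
    obtain ⟨p', rfl⟩ := hip
    obtain ⟨r, rfl, hr⟩ := ih ha p' fun x => congrFun (eq_of_mul_eval_eq hi.ne_zero
      ((MvPolynomial.continuous_eval a).mul hf) (MvPolynomial.continuous_eval p') fun x hx => by
        have := h x
        rw [map_mul, map_mul, mul_assoc] at this
        exact mul_left_cancel₀ hx this) x
    exact ⟨r, by ring, hr⟩

/-! ### Bounded exponents and recovery of coefficients from values -/

theorem finite_setOf_forall_le (X : Type) [Finite X] (N : ℕ) : {d : X →₀ ℕ | ∀ i, d i ≤ N}.Finite :=
  (Set.Finite.pi' fun _ : X => Set.finite_Iic N).preimage (f := fun d : X →₀ ℕ => ⇑d)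
    DFunLike.coe_injective.injOn

/-- The exponents bounded by `N` in each variable. -/
noncomputable def exponentBox (X : Type) [Finite X] (N : ℕ) : Finset (X →₀ ℕ) :=
  (finite_setOf_forall_le X N).toFinset

theorem mem_exponentBox {X : Type} [Finite X] {N : ℕ} {d : X →₀ ℕ} :
    d ∈ exponentBox X N ↔ ∀ i, d i ≤ N := by
  simp [exponentBox]

theorem support_subset_exponentBox {X : Type} [Finite X] {N : ℕ} {p : MvPolynomial X ℂ}
    (hp : p.totalDegree ≤ N) : p.support ⊆ exponentBox X N := fun _ hd =>
  mem_exponentBox.2 fun i => ((monomial_le_degreeOf i hd).trans (degreeOf_le_totalDegree p i)).trans hp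

theorem eval_eq_sum_of_support_subset {X : Type} {D : Finset (X →₀ ℕ)} {p : MvPolynomial X ℂ}
    (hp : p.support ⊆ D) (x : X → ℂ) :
    eval x p = ∑ d : D, p.coeff d.1 * d.1.prod fun i m => x i ^ m := by
  rw [Finset.sum_coe_sort D fun d => p.coeff d * d.prod fun i m => x i ^ m]
  rw [MvPolynomial.eval_eq]
  refine Finset.sum_subset hp fun d _ hd => ?_
  rw [notMem_support_iff.1 hd, zero_mul]

/-- The coefficients are linear combinations of the values at finitely many points. -/
theorem exists_interpolation {X : Type} [Finite X] (D : Finset (X →₀ ℕ)) :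
    ∃ c : D → (X → ℂ) →₀ ℂ, ∀ (a : D → ℂ) (d : D),
      (c d).sum (fun x t => t * ∑ e : D, a e * e.1.prod fun i m => x i ^ m) = a d := by
  let ev (x : X → ℂ) : Module.Dual ℂ (D → ℂ) :=
    ∑ e : D, (e.1.prod fun i m => x i ^ m) • LinearMap.proj e
  have hev : ∀ x a, ev x a = ∑ e : D, a e * e.1.prod fun i m => x i ^ m := fun x a => by
    simp [ev, mul_comm]
  -- The evaluations span the dual space, because a non-zero polynomial with exponents in `D` has a
  -- non-zero value somewhere.
  have hspan : Submodule.span ℂ (Set.range ev) = ⊤ := by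
    refine Submodule.span_eq_top_of_ne_zero fun a ha => ?_
    let p : MvPolynomial X ℂ := ∑ e : D, monomial e.1 (a e)
    have hp : p ≠ 0 := fun h0 => ha (funext fun d => by
      classical
      have := congrArg (coeff d.1) h0
      simpa only [p, coeff_sum, coeff_monomial, Subtype.coe_inj, Finset.sum_ite_eq',
        Finset.mem_univ, if_true, coeff_zero,
        Pi.zero_apply] using this)
    obtain ⟨x, hx⟩ := closure_nonempty_iff.1 ⟨_, mem_closure_eval_ne_zero hp 0⟩
    refine ⟨ev x, ⟨x, rfl⟩, ?_⟩
    rw [hev]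
    simpa [p, eval_monomial] using hx
  have : ∀ d : D, ∃ c : (X → ℂ) →₀ ℂ, Finsupp.linearCombination ℂ ev c = LinearMap.proj d :=
    fun d => Finsupp.mem_span_range_iff_exists_finsupp.1 (hspan ▸ Submodule.mem_top)
  choose c hc using this
  refine ⟨c, fun a d => ?_⟩
  have := congrArg (fun l : Module.Dual ℂ (D → ℂ) => l a) (hc d)
  simpa [Finsupp.linearCombination_apply, Finsupp.sum, hev] using this

/-- Specialization of the parameters. -/
noncomputable def specialize {P X : Type} (u : P → ℂ) :
    MvPolynomial (P ⊕ X) ℂ →ₐ[ℂ] MvPolynomial X ℂ :=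
  aeval (Sum.elim (fun i => C (u i)) MvPolynomial.X)

theorem eval_specialize {P X : Type} (u : P → ℂ) (x : X → ℂ) (p : MvPolynomial (P ⊕ X) ℂ) :
    eval x (specialize u p) = eval (Sum.elim u x) p := by
  have : (aeval x).comp (specialize u) = (aeval (Sum.elim u x) : MvPolynomial (P ⊕ X) ℂ →ₐ[ℂ] ℂ) := by
    ext i
    rcases i with i | i <;> simp [specialize]
  simpa [aeval_eq_eval] using congrArg (· p) this

/-- The uniformity in `u` is the point: one finite set of monomials serves the whole parameter
domain. -/
theorem exists_totalDegree_specialize_le {P X : Type} (p : MvPolynomial (P ⊕ X) ℂ) :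
    ∃ N, ∀ u, (specialize u p).totalDegree ≤ N := by
  induction p using MvPolynomial.induction_on with
  | C a => exact ⟨0, fun u => by simp [specialize]⟩
  | add p q hp hq =>
    obtain ⟨N, hN⟩ := hp
    obtain ⟨N', hN'⟩ := hq
    refine ⟨max N N', fun u => ?_⟩
    rw [map_add]
    exact (totalDegree_add _ _).trans (max_le_max (hN u) (hN' u))
  | mul_X p i hp =>
    obtain ⟨N, hN⟩ := hp
    refine ⟨N + 1, fun u => ?_⟩
    rw [map_mul]
    refine (totalDegree_mul _ _).trans (add_le_add (hN u) ?_)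
    rcases i with i | i <;> simp [specialize]

/-! ### Robust scalar functions and the coefficients of circuit results -/

/-- Geometrically robust scalar functions. -/
def RobustFun {ι : Type} (S : Set (ι → ℂ)) (f : (ι → ℂ) → ℂ) : Prop :=
  GeomRobustOn S fun z (_ : Unit) => f z

theorem RobustFun.comp_pi {ι κ : Type} [Finite ι] [Finite κ] {S : Set (ι → ℂ)} {T : Set (κ → ℂ)}
    {g : (κ → ℂ) → ℂ} (hg : RobustFun T g) (hS : Constructible S) {f : κ → (ι → ℂ) → ℂ}
    (hf : ∀ k, RobustFun S (f k)) (hm : ∀ z ∈ S, (fun k => f k z) ∈ T) :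
    RobustFun S fun z => g fun k => f k z :=
  GeomRobustOn.comp hg (GeomRobustOn.pi hS hf) hm

theorem RobustFun.polynomial {ι : Type} {S : Set (ι → ℂ)} (hS : Constructible S)
    (p : MvPolynomial ι ℂ) : RobustFun S fun z => eval z p :=
  GeomRobustOn.polynomial hS fun _ : Unit => p

theorem RobustFun.continuousOn {ι : Type} {S : Set (ι → ℂ)} {f : (ι → ℂ) → ℂ}
    (h : RobustFun S f) : ContinuousOn f S := continuousOn_pi.1 h.2 ()

/-- The set `K × 𝔸^X`. -/
def cylinder {P : Type} (K : Set (P → ℂ)) (X : Type) : Set (P ⊕ X → ℂ) :=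
  {z | (fun i => z (Sum.inl i)) ∈ K}

theorem elim_mem_cylinder {P X : Type} {K : Set (P → ℂ)} {u : P → ℂ} {x : X → ℂ} :
    Sum.elim u x ∈ cylinder K X ↔ u ∈ K := Iff.rfl

theorem elim_comp_inl_inr {P X : Type} (z : P ⊕ X → ℂ) :
    Sum.elim (fun i => z (.inl i)) (fun j => z (.inr j)) = z := Sum.elim_comp_inl_inr z

theorem continuous_elim_right {P X : Type} (u : P → ℂ) :
    Continuous fun x : X → ℂ => (Sum.elim u x : P ⊕ X → ℂ) :=
  continuous_pi fun i => by rcases i with i | i <;> simp only [Sum.elim_inl, Sum.elim_inr] <;> fun_prop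

theorem continuous_prod_pow {X : Type} (d : X →₀ ℕ) :
    Continuous fun x : X → ℂ => d.prod fun i m => x i ^ m := by
  unfold Finsupp.prod
  fun_prop

theorem constructible_of_cylinder {P X : Type} {K : Set (P → ℂ)}
    (h : Constructible (cylinder K X)) : Constructible K := by
  convert! h.preimage (Sum.elim MvPolynomial.X fun _ => 0 : P ⊕ X → MvPolynomial P ℂ) using 1
  ext u
  simp [cylinder]

theorem RobustFun.slice {P X : Type} [Finite P] [Finite X] {K : Set (P → ℂ)}
    {f : (P ⊕ X → ℂ) → ℂ} (hf : RobustFun (cylinder K X) f) (x : X → ℂ) :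
    RobustFun K fun u => f (Sum.elim u x) := by
  have hK := constructible_of_cylinder (GeomRobustOn.constructible hf)
  have := hf.comp_pi hK (f := fun k u => eval u
    ((Sum.elim MvPolynomial.X fun j => MvPolynomial.C (x j) : P ⊕ X → MvPolynomial P ℂ) k))
    (fun k => RobustFun.polynomial hK _) (fun u hu => by simpa [cylinder] using hu)
  convert! this using 3 with u
  funext k
  rcases k with k | k <;> simp

theorem RobustFun.linearCombination {ι α : Type} [Finite ι] {S : Set (ι → ℂ)}
    (hS : Constructible S) (c : α →₀ ℂ) {f : α → (ι → ℂ) → ℂ} (hf : ∀ a, RobustFun S (f a)) :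
    RobustFun S fun z => c.sum fun a t => t * f a z := by
  have := (RobustFun.polynomial (Constructible.univ (ι := c.support))
    (∑ a : c.support, MvPolynomial.C (c a) * MvPolynomial.X a)).comp_pi hS
    (f := fun a => f a.1) (fun a => hf a.1) (fun _ _ => trivial)
  convert! this using 2 with z
  simp only [Finsupp.sum, map_sum, map_mul, eval_C, eval_X]
  exact (Finset.sum_coe_sort c.support fun a => c a * f a z).symm

/-- The intermediate results of a consistent robust circuit are polynomials in the inputs whose
coefficients are geometrically robust functions of the parameters. -/
theorem Circuit.exists_robust_coefficients {P X : Type} [Finite P] [Finite X] (C : Circuit P X)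
    {K : Set (P → ℂ)} (hC : C.ConsistentOn (cylinder K X)) {Ω : (P ⊕ X → ℂ) → C.Node → ℂ}
    (hΩ : C.IsRobustExtension (cylinder K X) Ω) :
    ∃ (D : Finset (X →₀ ℕ)) (θ : C.Node → D → (P → ℂ) → ℂ),
      (∀ ν d, RobustFun K (θ ν d)) ∧
      ∀ u ∈ K, ∀ x ν, Ω (Sum.elim u x) ν = ∑ d : D, θ ν d u * d.1.prod fun i m => x i ^ m := by
  have := C.finite
  have := Fintype.ofFinite C.Node
  have hS : Constructible (cylinder K X) := hΩ.1.constructible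
  have hK := constructible_of_cylinder hS
  have hΩν : ∀ ν, RobustFun (cylinder K X) fun z => Ω z ν := fun ν => hΩ.1.component fun _ => ν
  choose N hN using fun ν => exists_totalDegree_specialize_le (C.frac ν).1
  let D := exponentBox X (Finset.univ.sup N)
  obtain ⟨c, hc⟩ := exists_interpolation D
  -- The candidate coefficients are interpolated from values of `Ω` at fixed inputs. They are thus
  -- robust on all of `K` before anything is known about the shape of the results.
  let θ (ν : C.Node) (d : D) (u : P → ℂ) : ℂ := (c d).sum fun x t => t * Ω (Sum.elim u x) ν
  have hθ : ∀ ν d, RobustFun K (θ ν d) := fun ν d =>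
    RobustFun.linearCombination hK (c d) fun x => (hΩν ν).slice x
  refine ⟨D, θ, hθ, ?_⟩
  -- Over a parameter point `u` where some evaluation succeeds, no denominator specializes to zero,
  -- so the result is a continuous quotient of polynomials in the inputs.
  have hgood : ∀ u ∈ K, ∀ x0 v0, C.IsEvaluation (Sum.elim u x0) v0 → ∀ x ν,
      Ω (Sum.elim u x) ν = ∑ d : D, θ ν d u * d.1.prod fun i m => x i ^ m := by
    intro u hu x0 v0 hv0 x ν
    rw [Circuit.isEvaluation_iff] at hv0
    have hne : ∀ μ, specialize u (C.frac μ).2 ≠ 0 := fun μ h0 => (hv0 μ).1 (by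
      rw [← eval_specialize, h0, map_zero])
    have hΩc : ∀ μ, Continuous fun x : X → ℂ => Ω (Sum.elim u x) μ := fun μ =>
      ((hΩν μ).continuousOn.comp_continuous (continuous_elim_right u) fun _ => hu)
    have hmul : ∀ x, eval x (specialize u (C.frac ν).2) * Ω (Sum.elim u x) ν =
        eval x (specialize u (C.frac ν).1) := by
      refine congrFun (eq_of_mul_eval_eq (q := ∏ μ, specialize u (C.frac μ).2)
        (Finset.prod_ne_zero_iff.2 fun μ _ => hne μ)
        ((MvPolynomial.continuous_eval _).mul (hΩc ν)) (MvPolynomial.continuous_eval _)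
        fun x hx => ?_)
      rw [map_prod] at hx
      have hx' : ∀ μ, eval (Sum.elim u x) (C.frac μ).2 ≠ 0 := fun μ => by
        rw [← eval_specialize]
        exact Finset.prod_ne_zero_iff.1 hx μ (Finset.mem_univ μ)
      rw [hΩ.2 (Sum.elim u x) hu _ (Circuit.isEvaluation_iff.2 fun μ => ⟨hx' μ, rfl⟩),
        eval_specialize, eval_specialize, mul_div_cancel₀ _ (hx' ν)]
    obtain ⟨r, hr, hΩr⟩ := exists_eval_eq_of_continuous (hne ν) _ (hΩc ν) hmul
    have hdeg : r.totalDegree ≤ Finset.univ.sup N := by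
      by_cases hr0 : r = 0
      · simp [hr0]
      · refine le_trans ?_ ((hN ν u).trans (Finset.le_sup (Finset.mem_univ ν)))
        rw [hr, totalDegree_mul_of_isDomain (hne ν) hr0]
        exact Nat.le_add_left _ _
    have hsum := eval_eq_sum_of_support_subset (support_subset_exponentBox hdeg)
    have hθr : ∀ d, θ ν d u = r.coeff d.1 := fun d => by
      rw [← hc (fun d => r.coeff d.1) d]
      simp only [θ, hΩr, hsum]
      rfl
    rw [hΩr, hsum]
    simp only [hθr]
    rfl
  intro u hu x ν
  have hinl : ContinuousOn (fun z : P ⊕ X → ℂ => fun i => z (Sum.inl i)) (cylinder K X) :=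
    Continuous.continuousOn (by fun_prop)
  -- There may be no evaluation over this `u`. Both sides are continuous on the whole cylinder, so
  -- the identity spreads from the points of evaluation.
  refine hC.eqOn hS (f := fun z => Ω z ν) (g := fun z => ∑ d : D, θ ν d (fun i => z (Sum.inl i)) *
    d.1.prod fun i m => z (Sum.inr i) ^ m) (hΩν ν).continuousOn ?_ ?_ (elim_mem_cylinder.2 hu)
  · refine continuousOn_finsetSum _ fun d _ => ContinuousOn.mul ?_ ?_
    · exact (hθ ν d).continuousOn.comp hinl fun z hz => hz
    · exact ((continuous_prod_pow d.1).comp (by fun_prop :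
        Continuous fun z : P ⊕ X → ℂ => fun i => z (Sum.inr i))).continuousOn
  · intro z hz v hv
    rw [← elim_comp_inl_inr z] at hv
    have := hgood _ hz _ v hv (fun j => z (Sum.inr j)) ν
    rwa [elim_comp_inl_inr] at this

/-! ### Functions which factor through a geometrically robust map -/

/-- `g` is the composition of `θ` with a geometrically robust function on the image of `θ`. -/
def Factors {P κ : Type} (K : Set (P → ℂ)) (θ : (P → ℂ) → κ → ℂ) (g : (P → ℂ) → ℂ) : Prop :=
  ∃ σ, RobustFun (θ '' K) σ ∧ ∀ u ∈ K, g u = σ (θ u)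

section Factors

variable {P κ : Type} [Finite P] [Finite κ] {K : Set (P → ℂ)} {θ : (P → ℂ) → κ → ℂ}

theorem Factors.robustFun {g : (P → ℂ) → ℂ} (h : Factors K θ g) (hθ : GeomRobustOn K θ) :
    RobustFun K g := by
  obtain ⟨σ, hσ, hg⟩ := h
  exact GeomRobustOn.congr (GeomRobustOn.comp hσ hθ fun u hu => ⟨u, hu, rfl⟩)
    fun u hu => funext fun _ => hg u hu

/-- The factorizations combine to a robust map on the image of `θ`, which is constructible by
Chevalley's theorem; `τ` is then composed with this map. -/
theorem Factors.comp {ι : Type} [Finite ι] (hθ : GeomRobustOn K θ) {g : ι → (P → ℂ) → ℂ}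
    (hg : ∀ i, Factors K θ (g i)) {T : Set (ι → ℂ)} {τ : (ι → ℂ) → ℂ} (hτ : RobustFun T τ)
    (hm : ∀ u ∈ K, (fun i => g i u) ∈ T) : Factors K θ fun u => τ fun i => g i u := by
  choose σ hσ hgσ using hg
  have hgσ' : ∀ u ∈ K, (fun i => g i u) = fun i => σ i (θ u) :=
    fun u hu => funext fun i => hgσ i u hu
  refine ⟨fun y => τ fun i => σ i y, hτ.comp_pi hθ.image hσ ?_, fun u hu => congrArg τ (hgσ' u hu)⟩
  rintro _ ⟨u, hu, rfl⟩
  rw [← hgσ' u hu]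
  exact hm u hu

theorem Factors.polynomial {ι : Type} [Finite ι] (hθ : GeomRobustOn K θ) {g : ι → (P → ℂ) → ℂ}
    (hg : ∀ i, Factors K θ (g i)) (p : MvPolynomial ι ℂ) :
    Factors K θ fun u => eval (fun i => g i u) p :=
  Factors.comp hθ hg (RobustFun.polynomial Constructible.univ p) fun _ _ => trivial

theorem Factors.component (hθ : GeomRobustOn K θ) (k : κ) : Factors K θ fun u => θ u k :=
  ⟨fun y => y k, by simpa using RobustFun.polynomial hθ.image (X k), fun _ _ => rfl⟩

/-- The functions which factor through `θ`. -/
def factorSubalgebra (hθ : GeomRobustOn K θ) : Subalgebra ℂ ((P → ℂ) → ℂ) where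
  carrier := {g | Factors K θ g}
  mul_mem' {g g'} hg hg' := by
    have := Factors.polynomial hθ (g := fun b : Bool => if b then g else g')
      (fun b => by cases b; exacts [hg', hg]) (X true * X false)
    simp only [map_mul, eval_X] at this
    exact this
  add_mem' {g g'} hg hg' := by
    have := Factors.polynomial hθ (g := fun b : Bool => if b then g else g')
      (fun b => by cases b; exacts [hg', hg]) (X true + X false)
    simp only [map_add, eval_X] at this
    exact this
  algebraMap_mem' c := by
    have := Factors.polynomial hθ (g := fun b : Empty => b.elim) (fun b => b.elim) (C c)
    simp only [eval_C] at this
    exact this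

/-- The value at a point. -/
def factorEval (hθ : GeomRobustOn K θ) (u : P → ℂ) : factorSubalgebra hθ →+* ℂ :=
  (Pi.evalRingHom (fun _ => ℂ) u).comp (factorSubalgebra hθ).subtype

theorem factorEval_apply (hθ : GeomRobustOn K θ) (u : P → ℂ) (g : factorSubalgebra hθ) :
    factorEval hθ u g = g.1 u := rfl

/-- `F` is a polynomial function whose coefficients factor through `θ`. -/
def IsPol (hθ : GeomRobustOn K θ) {X : Type} (F : (P → ℂ) → (X → ℂ) → ℂ) : Prop :=
  ∃ p : MvPolynomial X (factorSubalgebra hθ), ∀ u ∈ K, ∀ x,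
    F u x = eval₂Hom (factorEval hθ u) x p

namespace IsPol

variable {hθ : GeomRobustOn K θ} {X Y : Type}

theorem congr {F G : (P → ℂ) → (X → ℂ) → ℂ} (hF : IsPol hθ F)
    (h : ∀ u ∈ K, ∀ x, G u x = F u x) : IsPol hθ G := by
  obtain ⟨p, hp⟩ := hF
  exact ⟨p, fun u hu x => (h u hu x).trans (hp u hu x)⟩

theorem of_factors {g : (P → ℂ) → ℂ} (hg : Factors K θ g) :
    IsPol hθ fun u (_ : X → ℂ) => g u :=
  ⟨MvPolynomial.C ⟨g, hg⟩, fun u _ x => by simp [factorEval_apply]⟩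

theorem var (j : X) : IsPol hθ fun _ (x : X → ℂ) => x j :=
  ⟨MvPolynomial.X j, fun u _ x => by simp⟩

theorem zero : IsPol hθ fun _ (_ : X → ℂ) => 0 := ⟨0, fun _ _ _ => by simp⟩

/-- The coefficients form a ring, so substitution is `bind₁` of polynomials over it and no expansion
into monomials is needed. -/
theorem subst {F : (P → ℂ) → (X → ℂ) → ℂ} (hF : IsPol hθ F) {G : X → (P → ℂ) → (Y → ℂ) → ℂ}
    (hG : ∀ j, IsPol hθ (G j)) : IsPol hθ fun u y => F u fun j => G j u y := by
  obtain ⟨p, hp⟩ := hF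
  choose q hq using hG
  refine ⟨bind₁ q p, fun u hu y => ?_⟩
  simp only [eval₂Hom_bind₁, hp u hu, hq _ u hu]

theorem factors_eval {F : (P → ℂ) → (X → ℂ) → ℂ} (hF : IsPol hθ F) (x : X → ℂ) :
    Factors K θ fun u => F u x := by
  obtain ⟨p, hp⟩ := hF
  obtain ⟨σ, hσ, h⟩ := (eval (fun j => algebraMap ℂ (factorSubalgebra hθ) (x j)) p).2
  refine ⟨σ, hσ, fun u hu => ?_⟩
  simp only [← h u hu, hp u hu]
  rw [← factorEval_apply, eval, coe_eval₂Hom, coe_eval₂Hom, hom_eval₂]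
  rfl

theorem of_sum {F : (P → ℂ) → (X → ℂ) → ℂ} {D : Finset (X →₀ ℕ)} {c : D → (P → ℂ) → ℂ}
    (hc : ∀ d, Factors K θ (c d))
    (h : ∀ u ∈ K, ∀ x, F u x = ∑ d : D, c d u * d.1.prod fun i m => x i ^ m) : IsPol hθ F := by
  refine ⟨∑ d : D, monomial d.1 ⟨c d, hc d⟩, fun u hu x => ?_⟩
  rw [h u hu, map_sum]
  simp only [coe_eval₂Hom, eval₂_monomial, factorEval_apply]

theorem exists_sum {ι : Type} [Finite ι] {F : ι → (P → ℂ) → (X → ℂ) → ℂ}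
    (hF : ∀ k, IsPol hθ (F k)) :
    ∃ (D : Finset (X →₀ ℕ)) (c : ι → D → (P → ℂ) → ℂ), (∀ k d, Factors K θ (c k d)) ∧
      ∀ k, ∀ u ∈ K, ∀ x, F k u x = ∑ d : D, c k d u * d.1.prod fun i m => x i ^ m := by
  classical
  have := Fintype.ofFinite ι
  choose p hp using hF
  refine ⟨Finset.univ.biUnion fun k => (p k).support, fun k d => ((p k).coeff d.1).1,
    fun k d => ((p k).coeff d.1).2, fun k u hu x => ?_⟩
  rw [hp k u hu, coe_eval₂Hom, eval₂_eq, Finset.sum_coe_sort _ fun d : X →₀ ℕ =>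
    ((p k).coeff d).1 u * d.prod fun i m => x i ^ m]
  refine Finset.sum_subset (Finset.subset_biUnion_of_mem (fun k => (p k).support)
    (Finset.mem_univ k)) fun d _ hd => ?_
  rw [notMem_support_iff.1 hd, map_zero, zero_mul]

theorem continuousOn {F : (P → ℂ) → (X → ℂ) → ℂ} (hF : IsPol hθ F) :
    ContinuousOn (fun z : P ⊕ X → ℂ => F (fun i => z (.inl i)) fun j => z (.inr j))
      (cylinder K X) := by
  obtain ⟨D, c, hc, hs⟩ := exists_sum (ι := Unit) fun _ => hF
  refine ContinuousOn.congr (f := fun z : P ⊕ X → ℂ => ∑ d : D, c () d (fun i => z (.inl i)) *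
    d.1.prod fun i m => z (.inr i) ^ m) ?_ fun z hz => hs () _ hz _
  refine continuousOn_finsetSum _ fun d _ => ContinuousOn.mul ?_ ?_
  · exact ((hc () d).robustFun hθ).continuousOn.comp
      (Continuous.continuousOn (by fun_prop)) fun z hz => hz
  · exact ((continuous_prod_pow d.1).comp (by fun_prop :
      Continuous fun z : P ⊕ X → ℂ => fun i => z (Sum.inr i))).continuousOn

end IsPol

end Factors

/-! ### Results of robust circuits -/

namespace RobustCircuit

variable {M : ParamDomain} (β : RobustCircuit M)

theorem isRobustExtension :
    β.circ.IsRobustExtension (M.times β.X) (Classical.choose β.robust) :=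
  Classical.choose_spec β.robust

theorem result_eq {u : Fin M.r → ℂ} (hu : u ∈ M.carrier) {x : β.X → ℂ} {v : β.circ.Node → ℂ}
    (hv : β.circ.IsEvaluation (Sum.elim u x) v) (ν : β.circ.Node) : β.result ν u x = v ν :=
  congrFun (β.isRobustExtension.2 (Sum.elim u x) hu v hv) ν

theorem constructible_times : Constructible (M.times β.X) :=
  M.constructible.preimage_comp Sum.inl

theorem continuousOn_result (ν : β.circ.Node) :
    ContinuousOn (fun z : Fin M.r ⊕ β.X → ℂ =>
      β.result ν (fun i => z (.inl i)) fun j => z (.inr j)) (cylinder M.carrier β.X) := by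
  simp only [result, elim_comp_inl_inr]
  exact continuousOn_pi.1 β.isRobustExtension.1.2 ν

theorem eq_of_evaluation {F G : (Fin M.r → ℂ) → (β.X → ℂ) → ℂ}
    (hF : ContinuousOn (fun z : Fin M.r ⊕ β.X → ℂ => F (fun i => z (.inl i)) fun j => z (.inr j))
      (cylinder M.carrier β.X))
    (hG : ContinuousOn (fun z : Fin M.r ⊕ β.X → ℂ => G (fun i => z (.inl i)) fun j => z (.inr j))
      (cylinder M.carrier β.X))
    (h : ∀ u ∈ M.carrier, ∀ x v, β.circ.IsEvaluation (Sum.elim u x) v → F u x = G u x) :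
    ∀ u ∈ M.carrier, ∀ x, F u x = G u x := by
  have := β.finite
  intro u hu x
  exact β.consistent.eqOn β.constructible_times hF hG
    (fun z hz v hv => h _ hz _ v (by rwa [elim_comp_inl_inr])) (elim_mem_cylinder (x := x).2 hu)

/-- The criterion used for assembled circuits: a formula for the value at a node, checked only where
the circuit can be evaluated, determines the result everywhere by continuity. -/
theorem isPol_of_evaluation {κ : Type} [Finite κ] {θ : (Fin M.r → ℂ) → κ → ℂ}
    {hθ : GeomRobustOn M.carrier θ} {ν : β.circ.Node} {G : (Fin M.r → ℂ) → (β.X → ℂ) → ℂ}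
    (hG : IsPol hθ G)
    (h : ∀ u ∈ M.carrier, ∀ x v, β.circ.IsEvaluation (Sum.elim u x) v → v ν = G u x) :
    IsPol hθ (β.result ν) :=
  hG.congr (β.eq_of_evaluation (β.continuousOn_result ν) hG.continuousOn fun u hu x v hv =>
    (β.result_eq hu hv ν).trans (h u hu x v hv))

variable {β}

theorem isPol_of_isCoeffMap {κ : Type} [Finite κ] {θ : (Fin M.r → ℂ) → κ → ℂ}
    (hθ : GeomRobustOn M.carrier θ) {L : List β.circ.Node} {D : Finset (β.X →₀ ℕ)}
    {c : (Fin M.r → ℂ) → (Fin L.length × D) → ℂ} (hc : ∀ k, Factors M.carrier θ fun u => c u k)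
    (h : β.IsCoeffMap L D c) : ∀ ν ∈ L, IsPol hθ (β.result ν) := by
  intro ν hν
  obtain ⟨k, rfl⟩ := List.get_of_mem hν
  exact IsPol.of_sum (fun d => hc (k, d)) fun u hu x => h u hu x k

theorem exists_isCoeffMap {κ : Type} [Finite κ] {θ : (Fin M.r → ℂ) → κ → ℂ}
    {hθ : GeomRobustOn M.carrier θ} {L : List β.circ.Node}
    (h : ∀ ν ∈ L, IsPol hθ (β.result ν)) :
    ∃ (D : Finset (β.X →₀ ℕ)) (σ : (κ → ℂ) → (Fin L.length × D) → ℂ),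
      GeomRobustOn (θ '' M.carrier) σ ∧ β.IsCoeffMap L D fun u => σ (θ u) := by
  obtain ⟨D, c, hc, hs⟩ := IsPol.exists_sum fun k : Fin L.length => h (L.get k) (L.get_mem k)
  choose σ hσ hcσ using hc
  refine ⟨D, fun y k => σ k.1 k.2 y, GeomRobustOn.pi hθ.image fun k => hσ k.1 k.2, ?_⟩
  intro u hu x k
  rw [hs k u hu x]
  simp only [hcσ k _ u hu]

theorem exists_robust_isCoeffMap (β : RobustCircuit M) (L : List β.circ.Node) :
    ∃ (D : Finset (β.X →₀ ℕ)) (θ : (Fin M.r → ℂ) → (Fin L.length × D) → ℂ),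
      GeomRobustOn M.carrier θ ∧ β.IsCoeffMap L D θ := by
  have := β.finite
  obtain ⟨D, θ, hθ, h⟩ := β.circ.exists_robust_coefficients β.consistent β.isRobustExtension
  exact ⟨D, fun u k => θ (L.get k.1) k.2 u,
    GeomRobustOn.pi M.constructible fun k => hθ (L.get k.1) k.2,
    fun u hu x k => h u hu x (L.get k)⟩

end RobustCircuit

/-! ### Evaluations of assembled circuits -/

/-- Pulled back along `e`, an evaluation of the whole evaluates each piece, at the point where a
wired variable takes the value of the node replacing it. -/
theorem IsAssembly.isEvaluation {P X I : Type} {C : I → Piece}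
    {pw : ∀ i, (C i).P → P ⊕ (Σ j, (C j).circ.Node)}
    {xw : ∀ i, (C i).X → X ⊕ (Σ j, (C j).circ.Node)}
    {γ : Circuit P X} {e : (Σ i, (C i).circ.Node) → γ.Node} (h : IsAssembly C pw xw γ e)
    {z : P ⊕ X → ℂ} {w : γ.Node → ℂ} (hw : γ.IsEvaluation z w) (i : I) :
    (C i).circ.IsEvaluation
      (Sum.elim (fun k => (pw i k).elim (fun q => z (.inl q)) fun t => w (e t))
        fun k => (xw i k).elim (fun q => z (.inr q)) fun t => w (e t))
      fun ν => w (e ⟨i, ν⟩) := by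
  intro ν
  have hg := h.gate i ν
  have hwν := hw (e ⟨i, ν⟩)
  cases hν : (C i).circ.gate ν with
  | scalar c =>
    simp only [hν] at hg
    simpa only [hg] using hwν
  | param k =>
    simp only [hν] at hg
    cases hk : pw i k with
    | inl q =>
      simp only [hg.1 q hk] at hwν
      simpa [hk] using hwν
    | inr t => simp [hk, hg.2 t hk]
  | input k =>
    simp only [hν] at hg
    cases hk : xw i k with
    | inl q =>
      simp only [hg.1 q hk] at hwν
      simpa [hk] using hwν
    | inr t => simp [hk, hg.2 t hk]
  | op o a b =>
    simp only [hν] at hg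
    simp only [hg] at hwν
    cases o <;> exact hwν

theorem Circuit.map_parameterGate {P X : Type} (C : Circuit P X) (ν : {ν : C.Node // ¬ C.Dep ν}) :
    (C.parameterGate ν).map id Empty.elim Subtype.val = C.gate ν.1 := by
  unfold Circuit.parameterGate
  split
  · rename_i h; exact h.symm
  · rename_i h; exact h.symm
  · rename_i h; exact (ν.2 (Circuit.Dep.of_input h)).elim
  · rename_i h; exact h.symm

/-- An evaluation of a circuit restricts to its parameter nodes. -/
theorem Circuit.IsEvaluation.parameterPart {P X : Type} {C : Circuit P X} {z : P ⊕ X → ℂ}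
    {v : C.Node → ℂ} (hv : C.IsEvaluation z v) :
    C.parameterPart.IsEvaluation (Sum.elim (fun i => z (.inl i)) Empty.elim) fun ν => v ν.1 := by
  intro ν
  have hν := hv ν.1
  have hg : (C.parameterPart.gate ν).map id Empty.elim Subtype.val = C.gate ν.1 :=
    C.map_parameterGate ν
  rw [← hg] at hν
  cases h : C.parameterPart.gate ν with
  | scalar c => rw [h] at hν; exact hν
  | param i => rw [h] at hν; exact hν
  | input j => exact j.elim
  | op o a b => rw [h] at hν; cases o <;> exact hν

variable {κ : Type} [Finite κ] {M : ParamDomain} {θ : (Fin M.r → ℂ) → κ → ℂ}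
  {hθ : GeomRobustOn M.carrier θ}

/-! ### Recursion -/

/-- At a parameter node, the intermediate result is the value of the parameter part. -/
theorem RobustCircuit.result_eq_of_parameterPart (β : RobustCircuit M) {u : Fin M.r → ℂ}
    (hu : u ∈ M.carrier) {v : β.circ.parameterPart.Node → ℂ}
    (hv : β.circ.parameterPart.IsEvaluation (Sum.elim u Empty.elim) v)
    (ν : β.circ.parameterPart.Node) (x : β.X → ℂ) : β.result ν.1 u x = v ν := by
  let p := β.circ.parameterPart.frac ν
  have hc : ∀ q : MvPolynomial (Fin M.r ⊕ Empty) ℂ,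
      Continuous fun z : Fin M.r ⊕ β.X → ℂ => eval (Sum.elim (fun i => z (.inl i)) Empty.elim) q :=
    fun q => (MvPolynomial.continuous_eval q).comp (continuous_pi fun i => by
      rcases i with i | i
      · simp only [Sum.elim_inl]; fun_prop
      · exact i.elim)
  -- `β` need not be evaluable over this `u`. With the denominator cleared, the identity is one of
  -- continuous functions and extends from the points of evaluation; then one divides by the
  -- denominator, which is non-zero at `u`.
  have key := β.eq_of_evaluation
    (F := fun u x => eval (Sum.elim u Empty.elim) p.2 * β.result ν.1 u x)
    (G := fun u _ => eval (Sum.elim u Empty.elim) p.1)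
    ((hc p.2).continuousOn.mul (β.continuousOn_result ν.1)) (hc p.1).continuousOn
    (fun u hu x w hw => by
      obtain ⟨h1, h2⟩ := Circuit.isEvaluation_iff.1 hw.parameterPart ν
      simp only [Sum.elim_inl] at h1 h2
      rw [β.result_eq hu hw, h2, mul_div_cancel₀ _ h1]) u hu x
  obtain ⟨h1, h2⟩ := Circuit.isEvaluation_iff.1 hv ν
  rw [h2, eq_div_iff h1, mul_comm]
  exact key

theorem IsRecursionResult.isPol {S : Shape} {β γ : RobustCircuit M}
    (h : IsRecursionResult S β γ) (hβ : ∀ ν ∈ β.out, IsPol hθ (β.result ν)) :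
    ∀ ν ∈ γ.out, IsPol hθ (γ.result ν) := by
  obtain ⟨d, hY, hZ, v, e, -, -, has, hout, hiso⟩ := h
  intro ν hν
  rw [hout, List.mem_map] at hν
  obtain ⟨t, ht, rfl⟩ := hν
  obtain ⟨ρ, hρ, ht⟩ := List.mem_flatMap.1 ht
  by_cases hdep : β.circ.Dep ρ
  · obtain ⟨D, σ, hσ, hc⟩ := RobustCircuit.exists_isCoeffMap (L := [ρ])
      (fun ν hν => by rw [List.mem_singleton.1 hν]; exact hβ ρ hρ)
    have hf : ∀ k, Factors M.carrier θ fun u => σ (θ u) k := fun k =>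
      ⟨fun y => σ y k, hσ.component fun _ => k, fun _ _ => rfl⟩
    have hσθ : GeomRobustOn M.carrier fun u => σ (θ u) :=
      hσ.comp hθ fun u hu => ⟨u, hu, rfl⟩
    -- The isoparametricity condition at `ρ` is applied to a coefficient vector of the form `σ ∘ θ`,
    -- so the new coefficients are `σ' ∘ σ ∘ θ`.
    obtain ⟨D', σ', hσ', hc'⟩ := hiso ⟨ρ, hdep⟩ D _ hσθ hc
    refine RobustCircuit.isPol_of_isCoeffMap hθ (fun k => ?_) hc' _ (List.mem_map_of_mem ht)
    exact Factors.comp hθ hf (τ := fun y => σ' y k) (hσ'.component fun _ => k)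
      fun u hu => ⟨u, hu, rfl⟩
  · rw [RecChoice.refs, dif_neg hdep, List.mem_singleton] at ht
    subst ht
    -- The result at a parameter node does not depend on the inputs, so it may be read off at the
    -- input 0.
    refine γ.isPol_of_evaluation (IsPol.of_factors ((hβ ρ hρ).factors_eval 0))
      fun u hu x w hw => ?_
    refine (β.result_eq_of_parameterPart hu (v := fun ν => w (e ⟨.base, ν⟩)) ?_
      ⟨ρ, hdep⟩ 0).symm
    convert! has.isEvaluation hw RecPiece.base using 1
    funext k
    rcases k with k | k
    · rfl
    · exact k.elim

/-! ### Join, union and broadcasting -/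

theorem isPol_result_left {α δ γ : RobustCircuit M} {v : α.X → γ.X}
    {w : δ.X → γ.X ⊕ (Σ j, (twoPieces α δ j).circ.Node)}
    {e : (Σ i, (twoPieces α δ i).circ.Node) → γ.circ.Node}
    (h : IsAssembly (twoPieces α δ) (twoParamWire α δ) (twoInputWire α δ v w) γ.circ e)
    {ν : α.circ.Node} (hν : IsPol hθ (α.result ν)) : IsPol hθ (γ.result (e ⟨false, ν⟩)) :=
  γ.isPol_of_evaluation (hν.subst fun j => IsPol.var (v j)) fun _ hu _ _ hy =>
    (α.result_eq hu (h.isEvaluation hy false) ν).symm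

theorem IsUnion.isPol {α δ γ : RobustCircuit M} (h : IsUnion α δ γ)
    (hα : ∀ ν ∈ α.out, IsPol hθ (α.result ν)) (hδ : ∀ ν ∈ δ.out, IsPol hθ (δ.result ν)) :
    ∀ ν ∈ γ.out, IsPol hθ (γ.result ν) := by
  obtain ⟨v, w, e, -, -, has, hout⟩ := h
  intro ν hν
  rw [hout] at hν
  rcases List.mem_append.1 hν with hν | hν
  · obtain ⟨μ, hμ, rfl⟩ : ∃ μ : α.circ.Node, μ ∈ α.out ∧ e ⟨false, μ⟩ = ν := List.mem_map.1 hν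
    exact isPol_result_left has (hα μ hμ)
  · obtain ⟨μ, hμ, rfl⟩ : ∃ μ : δ.circ.Node, μ ∈ δ.out ∧ e ⟨true, μ⟩ = ν := List.mem_map.1 hν
    exact γ.isPol_of_evaluation ((hδ μ hμ).subst fun j => IsPol.var (w j)) fun _ hu _ _ hy =>
      (δ.result_eq hu (has.isEvaluation hy true) μ).symm

theorem IsJoin.isPol {α δ γ : RobustCircuit M} (h : IsJoin α δ γ)
    (hα : ∀ ν ∈ α.out, IsPol hθ (α.result ν)) (hδ : ∀ ν ∈ δ.out, IsPol hθ (δ.result ν)) :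
    ∀ ν ∈ γ.out, IsPol hθ (γ.result ν) := by
  obtain ⟨v, l, e, -, has, hout⟩ := h
  intro ν hν
  rw [hout] at hν
  obtain ⟨μ, hμ, rfl⟩ : ∃ μ : δ.circ.Node, μ ∈ δ.out ∧ e ⟨true, μ⟩ = ν := List.mem_map.1 hν
  refine γ.isPol_of_evaluation ((hδ μ hμ).subst fun k =>
    (hα (α.out.get (l k)) (List.get_mem _ _)).subst fun j => IsPol.var (v j))
    fun u hu x y hy => ?_
  have hpoint : (fun k => α.result (α.out.get (l k)) u fun j => x (v j)) =
      fun k => y (e ⟨false, α.out.get (l k)⟩) :=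
    funext fun k => α.result_eq hu (has.isEvaluation hy false) (α.out.get (l k))
  rw [hpoint]
  exact (δ.result_eq hu (has.isEvaluation hy true) μ).symm

theorem IsBroadcastStep.isPol {β γ : RobustCircuit M} (h : IsBroadcastStep β γ)
    (hβ : ∀ ν ∈ β.out, IsPol hθ (β.result ν)) : ∀ ν ∈ γ.out, IsPol hθ (γ.result ν) := by
  obtain ⟨δ, v, y, e, -, -, has, hout⟩ := h
  intro ν hν
  rw [hout] at hν
  obtain ⟨μ, hμ, rfl⟩ : ∃ μ : β.circ.Node, μ ∈ β.out ∧ e ⟨false, μ⟩ = ν := List.mem_map.1 hν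
  exact isPol_result_left has (hβ μ hμ)

/-! ### Reduction -/

theorem IsReductionStep.isPol {β γ : RobustCircuit M} (h : IsReductionStep β γ)
    (hβ : ∀ ν ∈ β.out, IsPol hθ (β.result ν)) : ∀ ν ∈ γ.out, IsPol hθ (γ.result ν) := by
  obtain ⟨ρ, ρ', v, f, hdep, heq, hv, hf, hbij, hgate, hout⟩ := h
  intro τ hτ
  obtain ⟨ν, hν, rfl⟩ := (hout τ).1 hτ
  let g : β.X ≃ γ.X := Equiv.ofBijective v hv
  let E := Equiv.ofBijective _ hbij
  -- The comparison runs from `β` to `γ`: the identified nodes have equal values, so an evaluation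
  -- of `β` descends. The density used below is accordingly that of the evaluations of `β`.
  have hlift : ∀ u ∈ M.carrier, ∀ x y, β.circ.IsEvaluation (Sum.elim u x) y →
      ∃ w, γ.circ.IsEvaluation (Sum.elim u fun j => x (g.symm j)) w ∧ ∀ μ, w (f μ) = y μ := by
    intro u hu x y hy
    have hyρ : y ρ = y ρ' := by rw [← β.result_eq hu hy, ← β.result_eq hu hy, heq u hu]
    have hw : ∀ μ, y (E.symm (f μ)).1 = y μ := fun μ => by
      by_cases hμ : μ = ρ'
      · subst hμ
        -- The two nodes are distinct, since every node depends on itself.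
        by_cases hρ : ρ = μ
        · subst hρ
          exact absurd Relation.ReflTransGen.refl hdep
        · rw [hf, ← hyρ]
          exact congrArg (fun t => y t.1) (E.symm_apply_apply ⟨ρ, hρ⟩)
      · exact congrArg (fun t => y t.1) (E.symm_apply_apply ⟨μ, hμ⟩)
    refine ⟨fun τ => y (E.symm τ).1, fun τ => ?_, hw⟩
    obtain ⟨⟨μ, hμ⟩, rfl⟩ := E.surjective τ
    have hg : γ.circ.gate (E ⟨μ, hμ⟩) = (β.circ.gate μ).map id v f := hgate μ hμ
    have hyμ := hy μ
    have hwμ : y (E.symm (E ⟨μ, hμ⟩)).1 = y μ := hw μ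
    cases hμg : β.circ.gate μ with
    | scalar c =>
      rw [hμg] at hg hyμ
      rw [hg]
      exact hwμ.trans hyμ
    | param i =>
      rw [hμg] at hg hyμ
      rw [hg]
      exact hwμ.trans hyμ
    | input j =>
      rw [hμg] at hg hyμ
      rw [hg]
      exact hwμ.trans (hyμ.trans (congrArg x (g.symm_apply_apply j).symm))
    | op o a b =>
      rw [hμg] at hg hyμ
      rw [hg]
      cases o <;> simp only [Gate.map, hwμ, hw] <;> exact hyμ
  have hcont : ContinuousOn (fun z : Fin M.r ⊕ β.X → ℂ =>
      γ.result (f ν) (fun i => z (.inl i)) fun j => z (.inr (g.symm j)))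
      (cylinder M.carrier β.X) := by
    refine (γ.continuousOn_result (f ν)).comp
      (f := fun z : Fin M.r ⊕ β.X → ℂ => fun k => z (Sum.map id g.symm k))
      (Continuous.continuousOn (by fun_prop)) fun z hz => hz
  have key := β.eq_of_evaluation (F := fun u x => γ.result (f ν) u fun j => x (g.symm j)) hcont
    (β.continuousOn_result ν) fun u hu x y hy => by
      obtain ⟨w, hw, hwy⟩ := hlift u hu x y hy
      rw [γ.result_eq hu hw, hwy, β.result_eq hu hy]
  refine ((hβ ν hν).subst fun j => IsPol.var (v j)).congr fun u hu x => ?_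
  rw [← key u hu]
  congr 1
  funext j
  exact congrArg x (g.apply_symm_apply j).symm

theorem IsRewriting.isPol {α γ : RobustCircuit M} (h : IsRewriting α γ)
    (hα : ∀ ν ∈ α.out, IsPol hθ (α.result ν)) : ∀ ν ∈ γ.out, IsPol hθ (γ.result ν) := by
  induction h with
  | refl => exact hα
  | tail _ hstep ih => exact hstep.elim (fun h => h.isPol ih) fun h => h.isPol ih

/-! ### Application of a generic computation -/

theorem IsApplication.isPol {R : GenericComputation} {ω β γ : RobustCircuit M}
    (h : IsApplication R ω β γ) (hω : ∀ ν ∈ ω.out, IsPol hθ (ω.result ν))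
    (hβ : ∀ ν ∈ β.out, IsPol hθ (β.result ν)) : ∀ ν ∈ γ.out, IsPol hθ (γ.result ν) := by
  obtain ⟨hpar, hW, hY, hZ, v, w, t, e, -, -, -, hcons, ⟨Ω, hΩ⟩, has, hout⟩ := h
  intro ν hν
  rw [hout] at hν
  obtain ⟨μ, hμ, rfl⟩ : ∃ μ : R.circ.Node, μ ∈ R.out ∧ e ⟨.gen, μ⟩ = ν := List.mem_map.1 hν
  have hωmem : ∀ i, entry ω.out hW i ∈ ω.out := fun i => List.get_mem _ _
  have hβmem : ∀ i, entry β.out hY i ∈ β.out := fun i => List.get_mem _ _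
  -- `cylinder K` is by definition the set on which `R` is assumed consistent and robust, so the
  -- coefficients of `R` are robust on `K`.
  let K : Set (Fin R.W → ℂ) :=
    {a | ∃ u ∈ M.carrier, ∀ i x, a i = ω.result (entry ω.out hW i) u x}
  let a (u : Fin M.r → ℂ) (i : Fin R.W) : ℂ := ω.result (entry ω.out hW i) u 0
  have haK : ∀ u ∈ M.carrier, a u ∈ K := fun u hu =>
    ⟨u, hu, fun i x => hpar _ (hωmem i) u hu 0 x⟩
  obtain ⟨D, c, hc, hs⟩ := R.circ.exists_robust_coefficients (K := K) hcons hΩ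
  let b (k : Fin R.Y ⊕ Fin R.Z ⊕ Fin R.X) (u : Fin M.r → ℂ) (x : γ.X → ℂ) : ℂ :=
    match k with
    | .inl k => β.result (entry β.out hY k) u fun j => x (v j)
    -- A dummy value: the second argument block is empty by `hZ`.
    | .inr (.inl _) => 0
    | .inr (.inr k) => x (t k)
  have hb : ∀ k, IsPol hθ (b k) := by
    rintro (k | k | k)
    · exact (hβ _ (hβmem k)).subst fun j => IsPol.var (v j)
    · exact IsPol.zero
    · exact IsPol.var (t k)
  -- The coefficients of `R`, robust on `K`, are composed with the parameter vector `a`, whose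
  -- entries factor through `θ`.
  have hF : IsPol hθ fun u (y : Fin R.Y ⊕ Fin R.Z ⊕ Fin R.X → ℂ) =>
      ∑ d : D, c μ d (a u) * d.1.prod fun i m => y i ^ m :=
    IsPol.of_sum (fun d => Factors.comp hθ
      (fun i => (hω _ (hωmem i)).factors_eval 0) (hc μ d) haK) fun _ _ _ => rfl
  refine γ.isPol_of_evaluation (hF.subst hb) fun u hu x y hy => ?_
  rw [← hs (a u) (haK u hu)]
  have hβe := has.isEvaluation hy AppPiece.arg
  have hωe := has.isEvaluation hy AppPiece.par
  have ha : a u = fun i => y (e ⟨.par, entry ω.out hW i⟩) := funext fun i =>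
    (hpar _ (hωmem i) u hu 0 _).trans (ω.result_eq hu hωe (entry ω.out hW i))
  have hbu : (fun k => b k u x) = Sum.elim (fun k => y (e ⟨.arg, entry β.out hY k⟩))
      (Sum.elim (fun k => (Fin.cast hZ k).elim0) fun k => x (t k)) := by
    funext k
    rcases k with k | k | k
    · exact β.result_eq hu hβe (entry β.out hY k)
    · exact (Fin.cast hZ k).elim0
    · rfl
  have hR : R.circ.IsEvaluation (Sum.elim (a u) fun k => b k u x) fun ν => y (e ⟨.gen, ν⟩) := by
    rw [ha, hbu]
    have := has.isEvaluation hy AppPiece.gen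
    refine Eq.mp (congrArg (fun z => R.circ.IsEvaluation z fun ν => y (e ⟨.gen, ν⟩)) ?_) this
    funext k
    rcases k with k | k | k | k
    · rfl
    · rfl
    · exact (Fin.cast hZ k).elim0
    · rfl
  exact (congrFun (hΩ.2 _ (elim_mem_cylinder.2 (haK u hu)) _ hR) μ).symm

/-! ### Elementary routines -/

/-- The circuits vary in the induction but `θ` does not: in a composition the intermediate circuit
is still measured by the coefficients of the original input. -/
theorem IsElementary.isPol {S : Shape} {A : Routine} (hA : IsElementary S A)
    {β γ : RobustCircuit M} (hγ : γ ∈ A M β) (hβ : ∀ ν ∈ β.out, IsPol hθ (β.result ν)) :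
    ∀ ν ∈ γ.out, IsPol hθ (γ.result ν) := by
  induction hA generalizing β γ with
  | identity =>
    obtain rfl : γ = β := Part.mem_some_iff.1 hγ
    exact hβ
  | recursion A h => exact (h M β γ hγ).isPol hβ
  | composition A B hA hB ihA ihB =>
    obtain ⟨α, hα, hγ⟩ := Part.mem_bind_iff.1 hγ
    exact ihB hγ (ihA hα hβ)
  | join A B C hA hB h ihA ihB =>
    obtain ⟨α, hα, δ, hδ, hj⟩ := h M β γ hγ
    exact hj.isPol (ihA hα hβ) (ihB hδ hβ)
  | union A B C hA hB h ihA ihB =>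
    obtain ⟨α, hα, δ, hδ, hj⟩ := h M β γ hγ
    exact hj.isPol (ihA hα hβ) (ihB hδ hβ)
  | application A C hA h ihA =>
    obtain ⟨R, -, ω, hω, happ⟩ := h M β γ hγ
    refine happ.isPol ?_ hβ
    -- Without parameter variables `ω` has no nodes, and nothing is to be shown.
    split_ifs at hω with hW
    · exact fun ν => hω.elim ν
    · exact ihA hω hβ
  | rewriting A C hA h ihA =>
    obtain ⟨α, hα, hr⟩ := h M β γ hγ
    exact hr.isPol (ihA hα hβ)

end RobustModel

theorem mainTheorem5 (S : RobustModel.Shape) (A : RobustModel.Routine)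
    (hA : RobustModel.IsElementary S A) (M : RobustModel.ParamDomain)
    (β γ : RobustModel.RobustCircuit M) (hγ : γ ∈ A M β) :
    (∃ (D : Finset (β.X →₀ ℕ)) (θ : (Fin M.r → ℂ) → (Fin β.out.length × D) → ℂ),
      RobustModel.GeomRobustOn M.carrier θ ∧ β.IsCoeffMap β.out D θ) ∧
    ∀ (D : Finset (β.X →₀ ℕ)) (θ : (Fin M.r → ℂ) → (Fin β.out.length × D) → ℂ),
      RobustModel.GeomRobustOn M.carrier θ → β.IsCoeffMap β.out D θ →
        RobustModel.Constructible (θ '' M.carrier) ∧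
        ∃ (D' : Finset (γ.X →₀ ℕ))
          (σ : ((Fin β.out.length × D) → ℂ) → (Fin γ.out.length × D') → ℂ),
          RobustModel.GeomRobustOn (θ '' M.carrier) σ ∧
            γ.IsCoeffMap γ.out D' (fun u => σ (θ u)) :=
  ⟨β.exists_robust_isCoeffMap β.out, fun _ _ hθ hc => ⟨hθ.image,
    RobustModel.RobustCircuit.exists_isCoeffMap (hA.isPol (hθ := hθ) hγ
      (RobustModel.RobustCircuit.isPol_of_isCoeffMap hθ
        (RobustModel.Factors.component hθ) hc))⟩⟩
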